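/- Let $\{0,1\}^{\mathbb Z}$ carry the product topology and let $\sigma$ be the left shift, $(\sigma y)(n)=y(n+1)$. A word $x\in\{0,1\}^{\mathbb Z}$ is a Toeplitz word if for every $a\in\mathbb Z$ there is an integer $p\ge 1$ with $x(a)=x(a+jp)$ for all $j\in\mathbb Z$. Its orbit closure $X_x=\overline{\{\sigma^j x: j\in\mathbb Z\}}$ is called a (binary) Toeplitz system. For $n\ge 1$ put $\mathrm{Per}_n(x)=\{a\in\mathbb Z: x(a)=x(a+jn)\text{ for all }j\in\mathbb Z\}$. The system $X_x$ is called regular if there are positive integers $n_0\mid n_1\mid n_2\mid\cdots$ with $\bigcup_{t\ge 0}\mathrm{Per}_{n_t}(x)=\mathbb Z$ such that the natural density of $\bigcup_{t=0}^{M}\mathrm{Per}_{n_t}(x)$ tends to $1$ as $M\to\infty$ (this does not depend on the choice of such a sequence $(n_t)$). Theorem. Let $k,l>1$ be distinct integers. Then there exists a Toeplitz word $x\in\{0,1\}^{\mathbb Z}$ such that $X_x$ is regular and the following hold. 1. For every continuous $F:X_x\to\mathbb C$ and every $y\in X_x$, the limit $$\lim_{N\to\infty}\frac1N\sum_{1\le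 m\le N}F(\sigma^{m^l}y)$$ exists. 2. For the continuous function $G:X_x\to\mathbb C$, $G(y)=(-1)^{y(0)}$, the limit $$\lim_{N\to\infty}\frac1N\sum_{1\le m\le N}G(\sigma^{m^k}x)$$ does not exist. Moreover, if $l$ is odd and some prime $q$ satisfies $q\mid k$ and $q\nmid l$, then $x$ can be chosen so that, in addition, $X_x$ has a unique $\sigma$-invariant Borel probability measure $\mu$ and the orbit $(\sigma^{m^l}y)_{m\ge1}$ of every point $y\in X_x$ is equidistributed with respect to $\mu$, that is, $$\lim_{N\to\infty}\frac1N\sum_{1\le m\le N}F(\sigma^{m^l}y)=\int_{X_x}F\,d\mu$$ for every continuous $F:X_x\to\mathbb C$ and every $y\in X_x$. -/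

import Mathlib

open Filter Topology MeasureTheory

namespace ToeplitzSystem

/-- Two-sided binary sequences `{0, 1}^ℤ`, with the product topology and the product `σ`-algebra. -/
abbrev Word : Type := ℤ → Fin 2

/-- The power `σ ^ j` (`j ∈ ℤ`) of the left shift `σ`, where `(σ y)(n) = y (n + 1)`. -/
def shift (j : ℤ) (y : Word) : Word := fun n => y (n + j)

theorem shift_zero (y : Word) : shift 0 y = y := by
  funext n
  simp [shift]

theorem shift_add (i j : ℤ) (y : Word) : shift (i + j) y = shift i (shift j y) := by
  funext n
  simp [shift, add_assoc]

theorem continuous_shift (j : ℤ) : Continuous (shift j) :=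
  continuous_pi fun n => continuous_apply (n + j)

/-- The orbit closure `X_x` of `x` under the shift. -/
def orbitClosure (x : Word) : Set Word := closure (Set.range fun j : ℤ => shift j x)

theorem self_mem_orbitClosure (x : Word) : x ∈ orbitClosure x :=
  subset_closure ⟨0, shift_zero x⟩

theorem shift_mem_orbitClosure (x : Word) (j : ℤ) {y : Word} (hy : y ∈ orbitClosure x) :
    shift j y ∈ orbitClosure x := by
  refine map_mem_closure (continuous_shift j) hy ?_
  rintro _ ⟨i, rfl⟩
  exact ⟨j + i, shift_add j i x⟩

/-- The power `σ ^ j` of the shift, as a self-map of the subshift `X_x`. -/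
def sigma (x : Word) (j : ℤ) (y : orbitClosure x) : orbitClosure x :=
  ⟨shift j y.1, shift_mem_orbitClosure x j y.2⟩

/-- The point `x` of `X_x`. -/
def basePoint (x : Word) : orbitClosure x := ⟨x, self_mem_orbitClosure x⟩

/-- Every position `a` of a Toeplitz word repeats along an arithmetic progression `a + ℓℤ`. -/
def IsToeplitz (x : Word) : Prop :=
  ∀ a : ℤ, ∃ p : ℤ, 0 < p ∧ ∀ k : ℤ, x a = x (a + k * p)

/-- `Per_p(x)`: the positions at which `x` is `p`-periodic. -/
def Per (p : ℕ) (x : Word) : Set ℤ := {a | ∀ k : ℤ, x a = x (a + k * p)}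

/-- The set `A ⊆ ℤ` has natural density `d`. -/
def HasDensity (A : Set ℤ) (d : ℝ) : Prop :=
  Tendsto (fun N : ℕ => ((A ∩ Set.Icc (-(N : ℤ)) N).ncard : ℝ) / (2 * N + 1)) atTop (𝓝 d)

/-- A period structure of `x`: positive integers `n 0 ∣ n 1 ∣ n 2 ∣ …` such that the sets
`Per_{n t}(x)` cover `ℤ`. -/
structure IsPeriodStructure (x : Word) (n : ℕ → ℕ) : Prop where
  pos : ∀ t, 0 < n t
  dvd : ∀ t, n t ∣ n (t + 1)
  cover : ⋃ t, Per (n t) x = Set.univ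

/-- The system `X_x` of a Toeplitz word `x` is regular: for a period structure `n` of `x`, the
density of `⋃_{t ≤ M} Per_{n t}(x)` tends to `1` as `M → ∞`. (The limit of these densities is the
same for every period structure of `x`.) -/
def IsRegularToeplitz (x : Word) : Prop :=
  ∃ n : ℕ → ℕ, IsPeriodStructure x n ∧
    ∃ d : ℕ → ℝ, (∀ M, HasDensity (⋃ t ≤ M, Per (n t) x) (d M)) ∧ Tendsto d atTop (𝓝 1)

/-- The function `G(y) = (-1)^{y(0)}` on `X_x`. -/
def signZero (x : Word) (y : orbitClosure x) : ℂ := (-1) ^ (y.1 0 : ℕ)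

/-- The average `(1/N) ∑_{1 ≤ m ≤ N} F(σ^{m^r} y)`. -/
noncomputable def powerAverage (x : Word) (r : ℕ) (F : orbitClosure x → ℂ) (y : orbitClosure x)
    (N : ℕ) : ℂ :=
  (1 / (N : ℂ)) * ∑ m ∈ Finset.Icc 1 N, F (sigma x ((m : ℤ) ^ r) y)

/-- `μ` is a `σ`-invariant Borel probability measure on `X_x`. -/
def IsInvariantProbability (x : Word) (μ : Measure (orbitClosure x)) : Prop :=
  IsProbabilityMeasure μ ∧ MeasurePreserving (sigma x 1) μ μ

end ToeplitzSystem

open ToeplitzSystem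

/-! The word `x` is built from nested periodic sets `W 0 = ℤ ⊇ W 1 ⊇ ...` of open positions; `x a`
is the parity of the first stage at which `a` is closed. Two demands compete. Almost all `k`-th
powers must stay open for long: stage `t + 1` closes everything up to some `N ^ k`, while at least
three quarters of the `m ^ k` with `m ≤ N` were still open. These all receive the sign `(-1) ^ (t +
1)`, so the averages along `k`-th powers oscillate. But `W t` must become sparse along `m` and `m ^
l`, uniformly in translates. Then, up to small error, averages along `m ^ l` at any point of the
orbit closure are averages of a periodic sequence, hence converge; sparsity along `m` gives
regularity.

Both demands are met by a sieve (`exists_isPowerSieve`): a set of residues modulo `M` with almost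
all `k`-th powers, but only a proportion `ε` of each translate of the `l`-th powers. Modulo a prime
`p ≡ 1 [MOD d]` with `d ∣ k`, `¬ d ∣ l`, the `k`-th powers serve: a character of order `d` is 1 on
the nonzero ones, yet its sum over `m ^ l + h` is `O(√p)`, so at most 3/4 of these values are `k`-th
powers. Coprime moduli multiply such factors. If `k ∣ l` no such `d` exists, and the `l`-th powers
are removed instead.

If `l` is odd and a prime `q` divides `k` but not `l`, one takes `d = q` and `p - 1` coprime to `l`.
Then `m ↦ m ^ l` permutes residues modulo every period, and averages along `m ^ l` and along `m`
share one limit, independent of the point; this limit defines the invariant measure. -/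

/-! ### Character sums over shifted powers -/

section CharacterSums

variable {p : ℕ} [Fact p.Prime]

/-- The summand is `χ` at `(a + h) / (b + h) = 1 + (a - b) / (b + h)`. With `0⁻¹ = 0` this is a
bijective function of `h`, so the full sum vanishes; the spurious term at `h = -b` is `χ 1 = 1`. -/
theorem sum_mulChar_mul_star_shift (χ : MulChar (ZMod p) ℂ) (hχ : χ ≠ 1) {a b : ZMod p}
    (hab : a ≠ b) : ∑ h, χ (a + h) * star (χ (b + h)) = -1 := by
  have hd : a - b ≠ 0 := sub_ne_zero.2 hab
  have h1 : ∀ h, χ (a + h) * star (χ (b + h)) =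
      χ (1 + (a - b) * (b + h)⁻¹) - if b + h = 0 then 1 else 0 := by
    intro h
    rw [← MulChar.star_apply, MulChar.star_eq_inv, MulChar.inv_apply']
    split_ifs with h0
    · rw [h0, inv_zero, MulChar.map_zero]; simp
    · rw [← map_mul, sub_zero]
      congr 1
      field_simp
      ring
  have h2 : ∑ h, χ (1 + (a - b) * (b + h)⁻¹) = 0 := by
    rw [← MulChar.sum_eq_zero_of_ne_one hχ]
    refine Fintype.sum_bijective (fun h => 1 + (a - b) * (b + h)⁻¹) ?_ _ _ fun _ => rfl
    rw [← Finite.injective_iff_bijective]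
    intro x y hxy
    have := mul_left_cancel₀ hd (add_left_cancel hxy)
    exact add_left_cancel (inv_injective this)
  have h3 : ∀ h, b + h = 0 ↔ h = -b := fun h => by
    constructor
    · intro e; linear_combination e
    · rintro rfl; ring
  simp_rw [h1, Finset.sum_sub_distrib, h2, h3]
  simp

theorem card_pow_eq_le {l : ℕ} (hl : 0 < l) (c : ZMod p) :
    (Finset.univ.filter fun m : ZMod p => m ^ l = c).card ≤ l := by
  classical
  calc _ ≤ (Polynomial.nthRoots l c).toFinset.card := by
        refine Finset.card_le_card fun m hm => ?_
        simpa [Polynomial.mem_nthRoots hl] using hm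
    _ ≤ _ := Multiset.toFinset_card_le _
    _ ≤ l := Polynomial.card_nthRoots l c

/-- After expanding the square, pairs with `m ^ l ≠ m' ^ l` contribute `-1` and are dropped; at most
`l * p` pairs remain, each contributing at most `p`. -/
theorem sum_normSq_shifted_power_sum_le (χ : MulChar (ZMod p) ℂ) (hχ : χ ≠ 1) {l : ℕ} (hl : 0 < l) :
    ∑ h, ‖∑ m, χ (m ^ l + h)‖ ^ 2 ≤ l * (p : ℝ) ^ 2 := by
  classical
  have e : ((∑ h, ‖∑ m, χ (m ^ l + h)‖ ^ 2 : ℝ) : ℂ) =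
      ∑ m : ZMod p, ∑ m' : ZMod p, ∑ h, χ (m ^ l + h) * star (χ (m' ^ l + h)) := by
    push_cast
    simp_rw [← Complex.mul_conj', map_sum, Finset.sum_mul_sum]
    rw [Finset.sum_comm]
    refine Finset.sum_congr rfl fun m _ => ?_
    rw [Finset.sum_comm]
    rfl
  have key : ∀ m m' : ZMod p, (∑ h, χ (m ^ l + h) * star (χ (m' ^ l + h))).re ≤
      if m' ^ l = m ^ l then (p : ℝ) else 0 := by
    intro m m'
    split_ifs with h
    · rw [h, Complex.re_sum]
      calc _ ≤ ∑ _h : ZMod p, (1 : ℝ) := by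
            refine Finset.sum_le_sum fun i _ => ?_
            have := DirichletCharacter.norm_le_one χ (m ^ l + i)
            have e2 := Complex.mul_conj' (χ (m ^ l + i))
            change (χ (m ^ l + i) * (starRingEnd ℂ) (χ (m ^ l + i))).re ≤ 1
            rw [e2, ← Complex.ofReal_pow, Complex.ofReal_re]
            exact pow_le_one₀ (norm_nonneg _) this
        _ = p := by simp [ZMod.card]
    · rw [sum_mulChar_mul_star_shift χ hχ (Ne.symm h)]
      norm_num
  have e2 := congrArg Complex.re e
  rw [Complex.ofReal_re] at e2
  rw [e2]
  simp_rw [Complex.re_sum] at key ⊢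
  calc _ ≤ ∑ m : ZMod p, ∑ m' : ZMod p, if m' ^ l = m ^ l then (p : ℝ) else 0 := by
        exact Finset.sum_le_sum fun m _ => Finset.sum_le_sum fun m' _ => key m m'
    _ ≤ ∑ m : ZMod p, (l : ℝ) * p := by
        refine Finset.sum_le_sum fun m _ => ?_
        rw [← Finset.sum_filter, Finset.sum_const, nsmul_eq_mul]
        gcongr
        exact card_pow_eq_le hl _
    _ = _ := by simp [ZMod.card]; ring

/-- A square-root bound without Weil: substituting `m ↦ s * m` shows that the norm is the same at
`h` and `h * s ^ l`. As `s` runs over the units, each shift occurs at most `l` times, so the second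
moment controls the single value. -/
theorem norm_shifted_power_sum_sq_le (χ : MulChar (ZMod p) ℂ) (hχ : χ ≠ 1) {l : ℕ} (hl : 0 < l)
    {h : ZMod p} (hh : h ≠ 0) : ‖∑ m, χ (m ^ l + h)‖ ^ 2 ≤ 2 * l ^ 2 * (p : ℝ) := by
  classical
  have hp2 : (2 : ℝ) ≤ p := by exact_mod_cast (Fact.out : p.Prime).two_le
  have dil : ∀ s : (ZMod p)ˣ, ‖∑ m, χ (m ^ l + h * s ^ l)‖ = ‖∑ m, χ (m ^ l + h)‖ := by
    intro s
    have : ∑ m, χ (m ^ l + h * s ^ l) = χ (s ^ l : ZMod p) * ∑ m, χ (m ^ l + h) := by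
      rw [Finset.mul_sum]
      refine (Fintype.sum_bijective (fun m => (s : ZMod p) * m) s.mulLeft_bijective _ _ ?_).symm
      intro m
      rw [← map_mul]
      congr 1
      ring
    rw [this, norm_mul, ← Units.val_pow_eq_pow_val, DirichletCharacter.unit_norm_eq_one, one_mul]
  set T : ZMod p → ℝ := fun h => ‖∑ m, χ (m ^ l + h)‖ ^ 2 with hT
  have h1 : ((p : ℝ) - 1) * T h ≤ l * ∑ h', T h' := by
    calc ((p : ℝ) - 1) * T h = ∑ s : (ZMod p)ˣ, T (h * s ^ l) := by
          simp only [hT, dil]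
          rw [Finset.sum_const, nsmul_eq_mul, Finset.card_univ, ZMod.card_units,
            Nat.cast_sub (Fact.out : p.Prime).one_le, Nat.cast_one]
      _ = ∑ h' : ZMod p, ∑ s ∈ Finset.univ.filter (fun s : (ZMod p)ˣ => h * (s : ZMod p) ^ l = h'), T (h * (s : ZMod p) ^ l) := by
          rw [Finset.sum_fiberwise]
      _ ≤ ∑ h' : ZMod p, l * T h' := by
          refine Finset.sum_le_sum fun h' _ => ?_
          calc _ = ∑ s ∈ Finset.univ.filter (fun s : (ZMod p)ˣ => h * (s : ZMod p) ^ l = h'), T h' := by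
                refine Finset.sum_congr rfl fun s hs => ?_
                rw [(Finset.mem_filter.1 hs).2]
            _ ≤ _ := by
              rw [Finset.sum_const, nsmul_eq_mul]
              have : 0 ≤ T h' := by positivity
              gcongr
              refine le_trans ?_ (card_pow_eq_le hl (h' / h))
              refine Finset.card_le_card_of_injOn (fun s => (s : ZMod p)) ?_
                (fun _ _ _ _ e => Units.ext e)
              intro s hs
              simp only [Finset.coe_filter, Finset.mem_univ, true_and, Set.mem_ofPred_eq] at hs ⊢
              rw [← hs]; field_simp
      _ = _ := by rw [Finset.mul_sum]
  have h2 := sum_normSq_shifted_power_sum_le χ hχ hl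
  have h3 : ((p : ℝ) - 1) * T h ≤ l * (l * (p : ℝ) ^ 2) :=
    h1.trans (mul_le_mul_of_nonneg_left h2 (by positivity))
  have hT0 : 0 ≤ T h := by positivity
  change T h ≤ _
  have h4 : (p : ℝ) / 2 * T h ≤ p / 2 * (2 * l ^ 2 * p) := by nlinarith
  exact le_of_mul_le_mul_left h4 (by linarith)

/-- If a set `A` lies where `χ ∈ {0, 1}` on the values `m ^ l + h`, it is not much larger than half
of `ZMod p`. -/
theorem card_shifted_power_le (χ : MulChar (ZMod p) ℂ) {l : ℕ} (hl : 0 < l)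
    (hp : 64 * l ^ 2 ≤ p) (h : ZMod p) (hcase : (h ≠ 0 ∧ χ ≠ 1) ∨ χ ^ l ≠ 1)
    (A : Finset (ZMod p)) (hA : ∀ m ∈ A, m ^ l + h = 0 ∨ χ (m ^ l + h) = 1) :
    (A.card : ℝ) ≤ 3 / 4 * p := by
  classical
  have hT : ‖∑ m, χ (m ^ l + h)‖ ^ 2 ≤ 2 * l ^ 2 * (p : ℝ) := by
    by_cases h0 : h = 0
    · have hχ : χ ^ l ≠ 1 := by tauto
      have : ∑ m, χ (m ^ l + h) = 0 := by
        rw [← MulChar.sum_eq_zero_of_ne_one hχ]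
        refine Finset.sum_congr rfl fun m _ => ?_
        rw [h0, add_zero, map_pow, MulChar.pow_apply' _ hl.ne']
      rw [this, norm_zero, zero_pow two_ne_zero]
      positivity
    · refine norm_shifted_power_sum_sq_le χ ?_ hl h0
      rintro rfl
      simp at hcase
  have hlow : (2 * A.card - p - l : ℝ) ≤ (∑ m, χ (m ^ l + h)).re := by
    calc (2 * A.card - p - l : ℝ) ≤ ∑ m : ZMod p, ((if m ∈ A then 2 else 0) - 1 -
          if m ^ l = -h then 1 else 0 : ℝ) := by
          simp only [Finset.sum_sub_distrib, ← Finset.sum_filter, Finset.sum_const, nsmul_eq_mul]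
          have : ((Finset.univ.filter fun m : ZMod p => m ^ l = -h).card : ℝ) ≤ l := by
            exact_mod_cast card_pow_eq_le hl (-h)
          simp [ZMod.card]
          linarith
      _ ≤ _ := by
          rw [Complex.re_sum]
          refine Finset.sum_le_sum fun m _ => ?_
          have hn := DirichletCharacter.norm_le_one χ (m ^ l + h)
          have hr := (abs_le.1 (Complex.abs_re_le_norm (χ (m ^ l + h)))).1
          by_cases hz : m ^ l = -h
          · have : m ^ l + h = 0 := by rw [hz]; ring
            rw [this, MulChar.map_zero, if_pos hz]
            split_ifs <;> norm_num
          · rw [if_neg hz]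
            by_cases hm : m ∈ A
            · rcases hA m hm with h' | h'
              · exact absurd (eq_neg_of_add_eq_zero_left h') hz
              · simp [h', hm]; norm_num
            · simp [hm]; linarith
  have hup : (2 * A.card - p - l : ℝ) ≤ ‖∑ m, χ (m ^ l + h)‖ :=
    hlow.trans ((le_abs_self _).trans (Complex.abs_re_le_norm _))
  by_contra hcon
  push Not at hcon
  have hl1 : (1 : ℝ) ≤ l := by exact_mod_cast hl
  have hp' : 64 * (l : ℝ) ^ 2 ≤ p := by exact_mod_cast hp
  -- More than `3p/4` elements would force the sum above `p/2 - l ≥ p/4`, hence `p ≤ 32 * l ^ 2`.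
  have h5 : (p : ℝ) / 4 ≤ ‖∑ m, χ (m ^ l + h)‖ := by nlinarith
  have h6 : ((p : ℝ) / 4) ^ 2 ≤ 2 * l ^ 2 * (p : ℝ) := (pow_le_pow_left₀ (by positivity) h5 2).trans hT
  have hp0 : (0 : ℝ) < p := by nlinarith
  have h7 : (p : ℝ) / 16 ≤ 2 * l ^ 2 := le_of_mul_le_mul_right (by linarith) hp0
  nlinarith

end CharacterSums

/-! ### Proportions of residues and the Chinese remainder theorem -/

section ResidueDensity

/-- The proportion of residues modulo `M` that lie in `S`. -/
noncomputable def residueDensity {M : ℕ} (S : Set (ZMod M)) : ℝ := S.ncard / M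

theorem residueDensity_nonneg {M : ℕ} (S : Set (ZMod M)) : 0 ≤ residueDensity S := by
  unfold residueDensity; positivity

theorem residueDensity_mono {M : ℕ} [NeZero M] {S T : Set (ZMod M)} (h : S ⊆ T) :
    residueDensity S ≤ residueDensity T := by
  unfold residueDensity
  gcongr
  exact Set.toFinite T

theorem residueDensity_le_one {M : ℕ} [NeZero M] (S : Set (ZMod M)) : residueDensity S ≤ 1 := by
  unfold residueDensity
  have hM : (0 : ℝ) < M := by exact_mod_cast NeZero.pos M
  rw [div_le_one hM]
  have := Set.ncard_le_ncard (Set.subset_univ S) (Set.toFinite _)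
  rw [Set.ncard_univ, Nat.card_zmod] at this
  exact_mod_cast this

theorem residueDensity_union_le {M : ℕ} (S T : Set (ZMod M)) :
    residueDensity (S ∪ T) ≤ residueDensity S + residueDensity T := by
  unfold residueDensity
  rw [← add_div]
  gcongr
  exact_mod_cast Set.ncard_union_le S T

theorem residueDensity_le_of_card_le {M : ℕ} [NeZero M] {S : Set (ZMod M)} {c : ℝ}
    (h : ∀ A : Finset (ZMod M), (∀ m ∈ A, m ∈ S) → (A.card : ℝ) ≤ c * M) :
    residueDensity S ≤ c := by
  classical
  have hM : (0 : ℝ) < M := by exact_mod_cast NeZero.pos M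
  unfold residueDensity
  rw [div_le_iff₀ hM, Set.ncard_eq_toFinset_card' S]
  exact h _ fun m hm => by simpa using hm

variable {M M' : ℕ}

theorem residueDensity_chineseRemainder (hc : M.Coprime M') (S : Set (ZMod M)) (T : Set (ZMod M')) :
    residueDensity (ZMod.chineseRemainder hc ⁻¹' (S ×ˢ T)) =
      residueDensity S * residueDensity T := by
  unfold residueDensity
  have : (ZMod.chineseRemainder hc ⁻¹' (S ×ˢ T)).ncard = S.ncard * T.ncard := by
    rw [← Set.ncard_prod]
    exact Set.ncard_preimage_of_injective_subset_range (ZMod.chineseRemainder hc).injective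
      (by simp [(ZMod.chineseRemainder hc).surjective.range_eq])
  rw [this]
  push_cast
  rw [mul_div_mul_comm]

theorem residueDensity_le_mul [NeZero M] [NeZero M'] (hc : M.Coprime M') {R : Set (ZMod (M * M'))}
    {S : Set (ZMod M)} {T : Set (ZMod M')} {c c' : ℝ} (hS : residueDensity S ≤ c)
    (hT : residueDensity T ≤ c')
    (h : ∀ m ∈ R, (ZMod.chineseRemainder hc m).1 ∈ S ∧ (ZMod.chineseRemainder hc m).2 ∈ T) :
    residueDensity R ≤ c * c' := by
  have : NeZero (M * M') := ⟨mul_ne_zero (NeZero.ne M) (NeZero.ne M')⟩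
  calc residueDensity R ≤ residueDensity (ZMod.chineseRemainder hc ⁻¹' (S ×ˢ T)) :=
        residueDensity_mono fun m hm => h m hm
    _ = _ := residueDensity_chineseRemainder hc S T
    _ ≤ c * c' := mul_le_mul hS hT (residueDensity_nonneg _) ((residueDensity_nonneg _).trans hS)

end ResidueDensity

/-! ### Power sieves -/

/-- A modulus `M` and a set `U` of residues that contains almost all `k`-th powers, but at most a
proportion `c` of every translate of the `l`-th powers. -/
structure IsPowerSieve (k l : ℕ) (H : Prop) (c ε : ℝ) (M : ℕ) (U : Set (ZMod M)) : Prop where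
  compl_le : residueDensity {m : ZMod M | m ^ k ∉ U} ≤ ε
  shift_le : ∀ h, residueDensity {m : ZMod M | m ^ l + h ∈ U} ≤ c
  fiber_le : ∀ b, residueDensity {m : ZMod M | m ^ k = b} ≤ ε
  inj : H → Function.Injective fun m : ZMod M => m ^ l

theorem IsPowerSieve.mono {k l : ℕ} {H : Prop} {c c' ε ε' : ℝ} {M : ℕ} {U : Set (ZMod M)}
    (h : IsPowerSieve k l H c ε M U) (hc : c ≤ c') (hε : ε ≤ ε') :
    IsPowerSieve k l H c' ε' M U :=
  ⟨h.compl_le.trans hε, fun b => (h.shift_le b).trans hc, fun b => (h.fiber_le b).trans hε, h.inj⟩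

theorem pow_injective_chineseRemainder {l M M' : ℕ} (hc : M.Coprime M')
    (h : Function.Injective fun m : ZMod M => m ^ l)
    (h' : Function.Injective fun m : ZMod M' => m ^ l) :
    Function.Injective fun m : ZMod (M * M') => m ^ l := by
  intro a b hab
  have e := congrArg (ZMod.chineseRemainder hc) hab
  simp only [map_pow] at e
  apply (ZMod.chineseRemainder hc).injective
  exact Prod.ext (h (congrArg Prod.fst e)) (h' (congrArg Prod.snd e))

/-- Under the Chinese remainder theorem the proportions of translated `l`-th powers multiply, while
the exceptional `k`-th powers only add up. -/
theorem IsPowerSieve.mul {k l : ℕ} {H : Prop} {c c' ε ε' : ℝ} {M M' : ℕ} [NeZero M] [NeZero M']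
    (hc : M.Coprime M') {U : Set (ZMod M)} {U' : Set (ZMod M')} (hU : IsPowerSieve k l H c ε M U)
    (hU' : IsPowerSieve k l H c' ε' M' U') :
    IsPowerSieve k l H (c * c') (ε + ε') (M * M') (ZMod.chineseRemainder hc ⁻¹' (U ×ˢ U')) where
  compl_le := by
    have : NeZero (M * M') := ⟨mul_ne_zero (NeZero.ne M) (NeZero.ne M')⟩
    calc _ ≤ residueDensity ({m : ZMod (M * M') | (ZMod.chineseRemainder hc m).1 ^ k ∉ U} ∪
            {m : ZMod (M * M') | (ZMod.chineseRemainder hc m).2 ^ k ∉ U'}) := by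
          refine residueDensity_mono fun m hm => ?_
          simp only [Set.mem_ofPred_eq, Set.mem_preimage, map_pow, Set.mem_prod, Prod.pow_fst,
            Prod.pow_snd, Set.mem_union] at hm ⊢
          tauto
      _ ≤ _ := residueDensity_union_le _ _
      _ ≤ ε * 1 + 1 * ε' := by
          gcongr
          · exact residueDensity_le_mul hc hU.compl_le (residueDensity_le_one Set.univ)
              fun m hm => ⟨hm, trivial⟩
          · exact residueDensity_le_mul hc (residueDensity_le_one Set.univ) hU'.compl_le
              fun m hm => ⟨trivial, hm⟩
      _ = _ := by ring
  shift_le h := by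
    refine residueDensity_le_mul hc (hU.shift_le (ZMod.chineseRemainder hc h).1)
      (hU'.shift_le (ZMod.chineseRemainder hc h).2) fun m hm => ?_
    simpa using hm
  fiber_le b := by
    have h0 : 0 ≤ ε' := (residueDensity_nonneg _).trans hU'.compl_le
    calc _ ≤ ε * 1 := by
          refine residueDensity_le_mul hc (hU.fiber_le (ZMod.chineseRemainder hc b).1)
            (residueDensity_le_one Set.univ) fun m hm => ⟨?_, trivial⟩
          simp only [Set.mem_ofPred_eq] at hm ⊢
          rw [← hm, map_pow, Prod.pow_fst]
      _ ≤ _ := by linarith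
  inj hH := pow_injective_chineseRemainder hc (hU.inj hH) (hU'.inj hH)

/-- Averaging the shift bound over all `h`: each `m` contributes exactly the size of `U`. -/
theorem residueDensity_sieve_le {k l : ℕ} {H : Prop} {c ε : ℝ} {M : ℕ} [NeZero M]
    {U : Set (ZMod M)} (hU : IsPowerSieve k l H c ε M U) : residueDensity U ≤ c := by
  classical
  have hM : (0 : ℝ) < M := by exact_mod_cast NeZero.pos M
  have h1 : ∀ h : ZMod M, (∑ m : ZMod M, if m ^ l + h ∈ U then (1 : ℝ) else 0) ≤ c * M := by
    intro h
    have := hU.shift_le h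
    unfold residueDensity at this
    rw [div_le_iff₀ hM, Set.ncard_eq_toFinset_card'] at this
    simpa [Finset.sum_boole] using this
  have h2 : ∑ h : ZMod M, (∑ m : ZMod M, if m ^ l + h ∈ U then (1 : ℝ) else 0) ≤
      ∑ _h : ZMod M, c * M := Finset.sum_le_sum fun h _ => h1 h
  rw [Finset.sum_comm] at h2
  have h3 : ∀ m : ZMod M, (∑ h : ZMod M, if m ^ l + h ∈ U then (1 : ℝ) else 0) = U.ncard := by
    intro m
    refine (Fintype.sum_equiv (Equiv.addLeft (m ^ l)) _ (fun u => if u ∈ U then (1 : ℝ) else 0)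
      fun h => rfl).trans ?_
    rw [Set.ncard_eq_toFinset_card']
    simp [Finset.sum_boole]
  simp only [h3, Finset.sum_const, Finset.card_univ, ZMod.card, nsmul_eq_mul] at h2
  unfold residueDensity
  rw [div_le_iff₀ hM]
  exact le_of_mul_le_mul_left h2 hM

section PrimeModulus

variable {p : ℕ} [Fact p.Prime]

theorem residueDensity_pow_eq_le {k : ℕ} (hk : 0 < k) {ε : ℝ} (hp : k ≤ ε * p) (b : ZMod p) :
    residueDensity {m : ZMod p | m ^ k = b} ≤ ε := by
  refine residueDensity_le_of_card_le fun A hA => le_trans ?_ hp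
  refine Nat.cast_le.2 (le_trans (Finset.card_le_card fun m hm => ?_) (card_pow_eq_le hk b))
  simpa using hA m hm

theorem residueDensity_shift_pow_le {k l : ℕ} (hl : 0 < l) (hp : 64 * l ^ 2 ≤ p)
    (χ : MulChar (ZMod p) ℂ) (hk : χ ^ k = 1) (h : ZMod p)
    (hcase : (h ≠ 0 ∧ χ ≠ 1) ∨ χ ^ l ≠ 1) :
    residueDensity {m : ZMod p | m ^ l + h ∈ Set.range fun u : ZMod p => u ^ k} ≤ 3 / 4 := by
  refine residueDensity_le_of_card_le fun A hA => card_shifted_power_le χ hl hp h hcase A ?_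
  intro m hm
  obtain ⟨u, hu⟩ := hA m hm
  by_cases hz : m ^ l + h = 0
  · exact Or.inl hz
  · right
    have hu' : IsUnit (u ^ k) := by
      simp only at hu
      rw [hu]; exact isUnit_iff_ne_zero.2 hz
    rcases ne_or_eq k 0 with k0 | k0
    · have huu : IsUnit u := (isUnit_pow_iff k0).1 hu'
      rw [← hu]
      simp only
      rw [map_pow, ← MulChar.pow_apply' _ k0, hk, MulChar.one_apply huu]
    · rw [← hu, k0]; simp

theorem exists_mulChar_orderOf_eq {d : ℕ} (hd : d ≠ 0) (hp : p ≡ 1 [MOD d]) :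
    ∃ χ : MulChar (ZMod p) ℂ, orderOf χ = d := by
  refine MulChar.exists_mulChar_orderOf (ZMod p) ?_ (Complex.isPrimitiveRoot_exp d hd)
  rw [ZMod.card]
  exact (Nat.modEq_iff_dvd' (Fact.out : p.Prime).one_le).1 hp.symm

theorem pow_injective_of_coprime {l : ℕ} (hl : 0 < l) (h : (p - 1).Coprime l) :
    Function.Injective fun m : ZMod p => m ^ l := by
  intro a b hab
  simp only at hab
  by_cases ha : a = 0
  · rw [ha, zero_pow hl.ne'] at hab
    rw [ha, eq_zero_of_pow_eq_zero hab.symm]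
  by_cases hb : b = 0
  · rw [hb, zero_pow hl.ne'] at hab
    rw [hb, eq_zero_of_pow_eq_zero hab]
  have hcard : (Nat.card (ZMod p)ˣ).Coprime l := by
    rwa [Nat.card_eq_fintype_card, ZMod.card_units]
  have := (powCoprime hcard).injective (a₁ := Units.mk0 a ha) (a₂ := Units.mk0 b hb)
    (Units.ext (by simpa [powCoprime] using hab))
  simpa using congrArg Units.val this

end PrimeModulus

theorem Nat.Prime.coprime_of_gt {p P : ℕ} (hp : p.Prime) (hP : 0 < P) (h : P < p) :
    p.Coprime P :=
  (hp.coprime_iff_not_dvd).2 fun hd => absurd (Nat.le_of_dvd hP hd) (not_le.2 h)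

/-- Sieves modulo a prime, when a character of order `d` separates `k`-th and `l`-th powers. -/
theorem exists_isPowerSieve_of_prime {k l d : ℕ} (hk : 0 < k) (hl : 0 < l) (hdk : d ∣ k)
    (hdl : ¬ d ∣ l) {H : Prop}
    (hprime : ∀ n : ℕ, ∃ p > n, p.Prime ∧ p ≡ 1 [MOD d] ∧ (H → (p - 1).Coprime l))
    {ε : ℝ} (hε : 0 < ε) {P : ℕ} (hP : 0 < P) :
    ∃ M U, 0 < M ∧ M.Coprime P ∧ IsPowerSieve k l H (3 / 4) ε M U := by
  -- The three terms ensure coprimality to `P`, the character bound, and fibres of proportion `k / p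
  -- ≤ ε`.
  obtain ⟨p, hpn, hp, hpd, hpl⟩ := hprime (P + 64 * l ^ 2 + ⌈k / ε⌉₊)
  have : Fact p.Prime := ⟨hp⟩
  have hd0 : d ≠ 0 := by rintro rfl; rw [zero_dvd_iff] at hdk; omega
  obtain ⟨χ, hχ⟩ := exists_mulChar_orderOf_eq hd0 hpd
  have hkp : (k : ℝ) ≤ ε * p := by
    rw [← div_le_iff₀' hε]
    refine (Nat.le_ceil _).trans ?_
    exact_mod_cast (by omega : ⌈k / ε⌉₊ ≤ p)
  have hχl : χ ^ l ≠ 1 := fun h => hdl (hχ ▸ orderOf_dvd_of_pow_eq_one h)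
  refine ⟨p, Set.range fun u => u ^ k, hp.pos, hp.coprime_of_gt hP (by omega), ?_, ?_, ?_, ?_⟩
  · have : {m : ZMod p | m ^ k ∉ Set.range fun u : ZMod p => u ^ k} = ∅ := by
      ext m; simp
    rw [this]
    simp [residueDensity, hε.le]
  · exact fun h => residueDensity_shift_pow_le hl (by omega) χ
      (orderOf_dvd_iff_pow_eq_one.1 (hχ ▸ hdk)) h (Or.inr hχl)
  · exact fun b => residueDensity_pow_eq_le hk hkp b
  · exact fun h => pow_injective_of_coprime hl (hpl h)

/-- Moduli for which most `k`-th powers are not `l`-th powers, when `k` properly divides `l`. -/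
theorem exists_modulus_few_pow_in_range {k l : ℕ} (hk : 1 < k) (hkl : k < l) (hdvd : k ∣ l)
    {ε : ℝ} (hε : 0 < ε) {P : ℕ} (hP : 0 < P) (s : ℕ) :
    ∃ M : ℕ, 0 < M ∧ M.Coprime P ∧
      residueDensity {m : ZMod M | m ^ k ∈ Set.range fun u : ZMod M => u ^ l} ≤ (3 / 4) ^ s ∧
      (∀ h : ZMod M, h ≠ 0 →
        residueDensity {m : ZMod M | m ^ l + h ∈ Set.range fun u : ZMod M => u ^ k} ≤ 3 / 4) ∧
      ∀ b, residueDensity {m : ZMod M | m ^ k = b} ≤ ε := by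
  have hk0 : 0 < k := zero_lt_one.trans hk
  have hl : 0 < l := hk0.trans hkl
  have hprime : ∀ Q : ℕ, 0 < Q → ∃ p : ℕ, 0 < p ∧ p.Coprime Q ∧
      residueDensity {m : ZMod p | m ^ k ∈ Set.range fun u : ZMod p => u ^ l} ≤ 3 / 4 ∧
      (∀ h : ZMod p, h ≠ 0 →
        residueDensity {m : ZMod p | m ^ l + h ∈ Set.range fun u : ZMod p => u ^ k} ≤ 3 / 4) ∧
      ∀ b, residueDensity {m : ZMod p | m ^ k = b} ≤ ε := by
    intro Q hQ
    obtain ⟨p, hp, hpn, hpl⟩ := Nat.exists_prime_gt_modEq_one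
      (Q + 64 * l ^ 2 + 64 * k ^ 2 + ⌈k / ε⌉₊) hl.ne'
    have : Fact p.Prime := ⟨hp⟩
    obtain ⟨ψ, hψ⟩ := exists_mulChar_orderOf_eq hl.ne' hpl
    have hkp : (k : ℝ) ≤ ε * p := by
      rw [← div_le_iff₀' hε]
      refine (Nat.le_ceil _).trans ?_
      exact_mod_cast (by omega : ⌈k / ε⌉₊ ≤ p)
    have hψk : ∀ j, 0 < j → j < l → ψ ^ j ≠ 1 := fun j hj hjl h =>
      absurd (Nat.le_of_dvd hj (hψ ▸ orderOf_dvd_of_pow_eq_one h)) (not_le.2 hjl)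
    obtain ⟨e, rfl⟩ := hdvd
    have he : 0 < e := Nat.pos_of_mul_pos_left hl
    refine ⟨p, hp.pos, hp.coprime_of_gt hQ (by omega), ?_, ?_, ?_⟩
    -- The roles are swapped: `ψ` of order `l` is trivial on `l`-th powers while `ψ ^ k ≠ 1`. Below,
    -- `ψ ^ e` with `l = k * e` plays the same part for `k`-th powers.
    · have := residueDensity_shift_pow_le hk0 (by omega) ψ (k := k * e)
        (orderOf_dvd_iff_pow_eq_one.1 (hψ ▸ dvd_rfl)) 0 (Or.inr (hψk k hk0 hkl))
      simpa using this
    · refine fun h hh => residueDensity_shift_pow_le hl (by omega) (ψ ^ e) ?_ h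
        (Or.inl ⟨hh, hψk e he (lt_mul_of_one_lt_left he hk)⟩)
      rw [← pow_mul, mul_comm]
      exact orderOf_dvd_iff_pow_eq_one.1 (hψ ▸ dvd_rfl)
    · exact fun b => residueDensity_pow_eq_le hk0 hkp b
  induction s with
  | zero =>
    obtain ⟨p, h0, h1, h2, h3, h4⟩ := hprime P hP
    have : NeZero p := ⟨h0.ne'⟩
    exact ⟨p, h0, h1, by simpa using residueDensity_le_one _, h3, h4⟩
  | succ s ih =>
    obtain ⟨M, h0, h1, h2, h3, h4⟩ := ih
    obtain ⟨p, g0, g1, g2, g3, g4⟩ := hprime (M * P) (by positivity)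
    have : NeZero M := ⟨h0.ne'⟩
    have : NeZero p := ⟨g0.ne'⟩
    have hc : M.Coprime p := (Nat.Coprime.coprime_mul_right_right g1).symm
    refine ⟨M * p, by positivity, h1.mul_left (Nat.Coprime.coprime_mul_left_right g1), ?_, ?_, ?_⟩
    · rw [pow_succ]
      refine residueDensity_le_mul hc h2 g2 ?_
      rintro m ⟨u, hu⟩
      simp only [Set.mem_ofPred_eq, Set.mem_range]
      have e := congrArg (ZMod.chineseRemainder hc) hu
      simp only [map_pow] at e
      exact ⟨⟨_, congrArg Prod.fst e⟩, ⟨_, congrArg Prod.snd e⟩⟩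
    · intro h hh
      set e := ZMod.chineseRemainder hc with he
      have hin : ∀ m : ZMod (M * p), (m ^ l + h ∈ Set.range fun u : ZMod (M * p) => u ^ k) →
          ((e m).1 ^ l + (e h).1 ∈ Set.range fun u : ZMod M => u ^ k) ∧
          ((e m).2 ^ l + (e h).2 ∈ Set.range fun u : ZMod p => u ^ k) := by
        rintro m ⟨u, hu⟩
        have e1 := congrArg e hu
        simp only [map_pow, map_add] at e1
        exact ⟨⟨(e u).1, congrArg Prod.fst e1⟩, ⟨(e u).2, congrArg Prod.snd e1⟩⟩
      -- A nonzero `h` may vanish modulo one factor, so only one factor 3/4 is kept here.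
      by_cases hz : (e h).1 = 0
      · have hz2 : (e h).2 ≠ 0 := fun hz2 => hh <| by
          apply e.injective
          rw [map_zero]
          exact Prod.ext hz hz2
        have := residueDensity_le_mul hc (residueDensity_le_one Set.univ) (g3 _ hz2)
          (R := {m | m ^ l + h ∈ Set.range fun u : ZMod (M * p) => u ^ k})
          fun m hm => ⟨trivial, (hin m hm).2⟩
        simpa using this
      · have := residueDensity_le_mul hc (h3 _ hz) (residueDensity_le_one Set.univ)
          (R := {m | m ^ l + h ∈ Set.range fun u : ZMod (M * p) => u ^ k})
          fun m hm => ⟨(hin m hm).1, trivial⟩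
        simpa using this
    · intro b
      have := residueDensity_le_mul hc (h4 (ZMod.chineseRemainder hc b).1)
        (residueDensity_le_one Set.univ) (R := {m | m ^ k = b}) fun m hm => ⟨by
          simp only [Set.mem_ofPred_eq] at hm ⊢
          rw [← hm, map_pow, Prod.pow_fst], trivial⟩
      simpa using this

/-- Every `l`-th power is now a `k`-th power, so the translate `h = 0` would lie inside the set of
`k`-th powers. Deleting the `l`-th powers empties it, at the cost of few `k`-th powers. -/
theorem exists_isPowerSieve_of_dvd {k l : ℕ} (hk : 1 < k) (hkl : k < l) (hdvd : k ∣ l) {H : Prop}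
    (hH : ¬ H) {ε : ℝ} (hε : 0 < ε) {P : ℕ} (hP : 0 < P) :
    ∃ M U, 0 < M ∧ M.Coprime P ∧ IsPowerSieve k l H (3 / 4) ε M U := by
  obtain ⟨s, hs⟩ := exists_pow_lt_of_lt_one hε (by norm_num : (3 / 4 : ℝ) < 1)
  obtain ⟨M, h0, h1, h2, h3, h4⟩ := exists_modulus_few_pow_in_range hk hkl hdvd hε hP s
  have : NeZero M := ⟨h0.ne'⟩
  refine ⟨M, Set.range (fun u => u ^ k) \ Set.range (fun u => u ^ l), h0, h1, ?_, ?_, h4,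
    fun h => absurd h hH⟩
  · refine le_trans (residueDensity_mono fun m hm => ?_) (h2.trans hs.le)
    by_contra hcon
    exact hm ⟨⟨m, rfl⟩, hcon⟩
  · intro h
    by_cases hz : h = 0
    · have : {m : ZMod M | m ^ l + h ∈ Set.range (fun u : ZMod M => u ^ k) \
          Set.range (fun u : ZMod M => u ^ l)} = ∅ := by
        ext m; simp [hz]
      rw [this]
      norm_num [residueDensity]
    · exact (residueDensity_mono fun m hm => hm.1).trans (h3 h hz)

/-- Dirichlet's theorem with `p ≡ 1` modulo `q` and `p ≡ 2` modulo `l`; the class 2 is a unit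
because `l` is odd, and it gives `p - 1 ≡ 1` modulo `l`. -/
theorem exists_prime_gt_modEq_one_sub_one_coprime {q l : ℕ} (hq : q.Prime) (hl : Odd l)
    (hql : ¬ q ∣ l) (n : ℕ) : ∃ p > n, p.Prime ∧ p ≡ 1 [MOD q] ∧ (p - 1).Coprime l := by
  have hc : q.Coprime l := (hq.coprime_iff_not_dvd).2 hql
  obtain ⟨a, ha1, ha2⟩ := Nat.chineseRemainder hc 1 2
  have h1 : a.Coprime (q * l) := by
    refine Nat.Coprime.mul_right ?_ ?_
    · rw [Nat.Coprime, ha1.gcd_eq]; simp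
    · rw [Nat.Coprime, ha2.gcd_eq]; exact Nat.coprime_two_left.2 hl
  obtain ⟨p, hpn, hp, hpa⟩ := Nat.forall_exists_prime_gt_and_modEq n
    (mul_ne_zero hq.ne_zero hl.pos.ne') h1
  refine ⟨p, hpn, hp, (hpa.of_mul_right l).trans ha1, ?_⟩
  have h2 : p ≡ 2 [MOD l] := (hpa.of_mul_left q).trans ha2
  have h3 : p - 1 ≡ 1 [MOD l] := by
    have : (p - 1) + 1 ≡ 1 + 1 [MOD l] := by rwa [Nat.sub_add_cancel hp.one_le]
    exact Nat.ModEq.add_right_cancel' 1 this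
  rw [Nat.Coprime, h3.gcd_eq]; simp

theorem exists_isPowerSieve_three_quarters {k l : ℕ} (hk : 1 < k) (hl : 1 < l) (hkl : k ≠ l)
    {ε : ℝ} (hε : 0 < ε) {P : ℕ} (hP : 0 < P) :
    ∃ M U, 0 < M ∧ M.Coprime P ∧
      IsPowerSieve k l (Odd l ∧ ∃ q : ℕ, q.Prime ∧ q ∣ k ∧ ¬ q ∣ l) (3 / 4) ε M U := by
  by_cases H : Odd l ∧ ∃ q : ℕ, q.Prime ∧ q ∣ k ∧ ¬ q ∣ l
  · obtain ⟨ho, q, hq, hqk, hql⟩ := H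
    refine exists_isPowerSieve_of_prime (by omega) (by omega) hqk hql (fun n => ?_) hε hP
    obtain ⟨p, h1, h2, h3, h4⟩ := exists_prime_gt_modEq_one_sub_one_coprime hq ho hql n
    exact ⟨p, h1, h2, h3, fun _ => h4⟩
  · by_cases hdvd : k ∣ l
    · exact exists_isPowerSieve_of_dvd (by omega)
        (lt_of_le_of_ne (Nat.le_of_dvd (by omega) hdvd) hkl) hdvd H hε hP
    · refine exists_isPowerSieve_of_prime (by omega) (by omega) dvd_rfl hdvd (fun n => ?_) hε hP
      obtain ⟨p, h1, h2, h3⟩ := Nat.exists_prime_gt_modEq_one n (by omega : k ≠ 0)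
      exact ⟨p, h2, h1, h3, fun h => absurd h H⟩

theorem exists_isPowerSieve {k l : ℕ} (hk : 1 < k) (hl : 1 < l) (hkl : k ≠ l) {ε : ℝ}
    (hε : 0 < ε) :
    ∃ M U, 0 < M ∧ IsPowerSieve k l (Odd l ∧ ∃ q : ℕ, q.Prime ∧ q ∣ k ∧ ¬ q ∣ l) ε ε M U := by
  -- The error is quantified inside the induction, since each product adds two errors and so needs
  -- halves.
  suffices h : ∀ r : ℕ, ∀ ε : ℝ, 0 < ε → ∃ M U, 0 < M ∧
      IsPowerSieve k l (Odd l ∧ ∃ q : ℕ, q.Prime ∧ q ∣ k ∧ ¬ q ∣ l) ((3 / 4) ^ (r + 1)) ε M U by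
    obtain ⟨r, hr⟩ := exists_pow_lt_of_lt_one hε (by norm_num : (3 / 4 : ℝ) < 1)
    obtain ⟨M, U, hM, hU⟩ := h r ε hε
    refine ⟨M, U, hM, hU.mono (le_trans ?_ hr.le) le_rfl⟩
    exact pow_le_pow_of_le_one (by norm_num) (by norm_num) (Nat.le_succ r)
  intro r
  induction r with
  | zero =>
    intro ε hε
    obtain ⟨M, U, h0, -, h⟩ := exists_isPowerSieve_three_quarters hk hl hkl hε one_pos
    exact ⟨M, U, h0, by simpa using h⟩
  | succ r ih =>
    intro ε hε
    obtain ⟨M, U, h0, h⟩ := ih (ε / 2) (half_pos hε)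
    obtain ⟨M', U', g0, gc, g⟩ := exists_isPowerSieve_three_quarters hk hl hkl (half_pos hε) h0
    have : NeZero M := ⟨h0.ne'⟩
    have : NeZero M' := ⟨g0.ne'⟩
    have := h.mul gc.symm g
    rw [add_halves, ← pow_succ] at this
    exact ⟨M * M', _, by positivity, this⟩

/-! ### Means of periodic sequences and counting densities -/

section PeriodicSums

theorem sum_range_add_of_periodic {E : Type*} [AddCommGroup E] {n : ℕ} {f : ℤ → E} (hf : ∀ a, f (a + n) = f a) (a : ℤ) :
    ∑ i ∈ Finset.range n, f (a + i) = ∑ i ∈ Finset.range n, f i := by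
  have step : ∀ a : ℤ, ∑ i ∈ Finset.range n, f (a + 1 + i) = ∑ i ∈ Finset.range n, f (a + i) := by
    intro a
    have h1 := Finset.sum_range_succ (fun i : ℕ => f (a + i)) n
    have h2 := Finset.sum_range_succ' (fun i : ℕ => f (a + i)) n
    rw [h1, hf, Nat.cast_zero, add_zero] at h2
    rw [add_right_cancel h2]
    refine Finset.sum_congr rfl fun i _ => ?_
    congr 1
    push_cast
    ring
  induction a using Int.induction_on with
  | zero => simp
  | succ i ih => rw [step, ih]
  | pred i ih => rw [← step, sub_add_cancel, ih]

theorem sum_Icc_one_eq_sum_range {E : Type*} [AddCommMonoid E] (f : ℤ → E) (N : ℕ) :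
    ∑ m ∈ Finset.Icc 1 N, f m = ∑ i ∈ Finset.range N, f (1 + i) := by
  rw [← Finset.Ico_add_one_right_eq_Icc, Finset.sum_Ico_eq_sum_range]
  simp

variable {E : Type*} [NormedAddCommGroup E] [NormedSpace ℝ E]

/-- The mean of `f` over `0, …, n - 1`. -/
noncomputable def periodMean (n : ℕ) (f : ℤ → E) : E := (n : ℝ)⁻¹ • ∑ i ∈ Finset.range n, f i

/-- Once the mean is subtracted, full periods cancel, leaving less than one period; hence the bound
depends on neither the start nor the length. -/
theorem exists_norm_sum_sub_periodMean_le {n : ℕ} (hn : 0 < n) {f : ℤ → E}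
    (hf : ∀ a, f (a + n) = f a) :
    ∃ C : ℝ, ∀ (a : ℤ) (N : ℕ),
      ‖∑ i ∈ Finset.range N, f (a + i) - (N : ℝ) • periodMean n f‖ ≤ C := by
  set g : ℤ → E := fun a => f a - periodMean n f with hg
  have hgp : ∀ a, g (a + n) = g a := fun a => by simp [hg, hf]
  have hg0 : ∑ i ∈ Finset.range n, g i = 0 := by
    have : (n : ℝ) ≠ 0 := by exact_mod_cast hn.ne'
    simp only [hg, Finset.sum_sub_distrib, Finset.sum_const, Finset.card_range, periodMean]
    rw [← Nat.cast_smul_eq_nsmul ℝ, smul_smul, mul_inv_cancel₀ this, one_smul, sub_self]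
  have hS : ∀ (a : ℤ) (N : ℕ), ∑ i ∈ Finset.range N, f (a + i) - (N : ℝ) • periodMean n f =
      ∑ i ∈ Finset.range N, g (a + i) := by
    intro a N
    simp only [hg, Finset.sum_sub_distrib, Finset.sum_const, Finset.card_range]
    rw [Nat.cast_smul_eq_nsmul]
  refine ⟨∑ i ∈ Finset.range n, ‖g i‖, fun a N => ?_⟩
  rw [hS]
  induction N using Nat.strong_induction_on with
  | _ N ih =>
    by_cases hN : N < n
    · refine (norm_sum_le _ _).trans ?_
      rw [← sum_range_add_of_periodic (f := fun a => ‖g a‖) (fun a => by simp only [hgp]) a]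
      exact Finset.sum_le_sum_of_subset_of_nonneg
        (Finset.range_subset_range.2 hN.le) fun _ _ _ => norm_nonneg _
    · obtain ⟨N', rfl⟩ := Nat.exists_eq_add_of_le' (not_lt.1 hN)
      rw [Finset.sum_range_add]
      have : ∑ x ∈ Finset.range n, g (a + (N' + x : ℕ)) = 0 := by
        rw [← hg0, ← sum_range_add_of_periodic hgp (a + N')]
        refine Finset.sum_congr rfl fun i _ => ?_
        congr 1
        push_cast
        ring
      rw [this, add_zero]
      exact ih N' (by omega)

end PeriodicSums

open Classical in
/-- The number of elements of `A` among `1, …, N`. -/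
noncomputable def countUpTo (A : Set ℕ) (N : ℕ) : ℕ := ((Finset.Icc 1 N).filter (· ∈ A)).card

theorem countUpTo_mono {A B : Set ℕ} (h : A ⊆ B) (N : ℕ) : countUpTo A N ≤ countUpTo B N := by
  classical
  exact Finset.card_le_card fun m hm => by
    simp only [Finset.mem_filter] at hm ⊢
    exact ⟨hm.1, h hm.2⟩

theorem countUpTo_union_le (A B : Set ℕ) (N : ℕ) :
    countUpTo (A ∪ B) N ≤ countUpTo A N + countUpTo B N := by
  classical
  unfold countUpTo
  refine le_trans (Finset.card_le_card ?_) (Finset.card_union_le _ _)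
  intro m hm
  simp only [Finset.mem_filter, Finset.mem_union, Set.mem_union] at hm ⊢
  tauto

/-- The set `A` has at most `δ N + C` elements among `1, …, N`. -/
def DensityLE (A : Set ℕ) (δ : ℝ) : Prop := ∃ C : ℝ, ∀ N : ℕ, (countUpTo A N : ℝ) ≤ δ * N + C

theorem DensityLE.mono {A B : Set ℕ} {δ : ℝ} (h : DensityLE B δ) (hAB : A ⊆ B) :
    DensityLE A δ := by
  obtain ⟨C, hC⟩ := h
  exact ⟨C, fun N => le_trans (by exact_mod_cast countUpTo_mono hAB N) (hC N)⟩

theorem DensityLE.union {A B : Set ℕ} {δ δ' : ℝ} (h : DensityLE A δ) (h' : DensityLE B δ') :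
    DensityLE (A ∪ B) (δ + δ') := by
  obtain ⟨C, hC⟩ := h
  obtain ⟨C', hC'⟩ := h'
  refine ⟨C + C', fun N => ?_⟩
  have : (countUpTo (A ∪ B) N : ℝ) ≤ countUpTo A N + countUpTo B N := by
    exact_mod_cast countUpTo_union_le A B N
  linarith [hC N, hC' N]

theorem densityLE_empty : DensityLE ∅ 0 := ⟨0, fun N => by simp [countUpTo]⟩

theorem DensityLE.biUnion {ι : Type*} (s : Finset ι) {A : ι → Set ℕ} {δ : ℝ}
    (h : ∀ i ∈ s, DensityLE (A i) δ) : DensityLE (⋃ i ∈ s, A i) (s.card * δ) := by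
  classical
  induction s using Finset.induction_on with
  | empty => simpa using densityLE_empty
  | insert a s ha ih =>
    rw [Finset.set_biUnion_insert, Finset.card_insert_of_notMem ha]
    have := (h a (Finset.mem_insert_self _ _)).union
      (ih fun i hi => h i (Finset.mem_insert_of_mem hi))
    convert this using 1
    push_cast
    ring

theorem densityLE_of_residueDensity_le {M : ℕ} [NeZero M] {S : Set (ZMod M)} {δ : ℝ}
    (h : residueDensity S ≤ δ) : DensityLE {m : ℕ | (m : ZMod M) ∈ S} δ := by
  classical
  have hM : (0 : ℝ) < M := by exact_mod_cast NeZero.pos M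
  set f : ℤ → ℝ := fun a => if (a : ZMod M) ∈ S then 1 else 0 with hf
  obtain ⟨C, hC⟩ := exists_norm_sum_sub_periodMean_le (NeZero.pos M) (f := f)
    (fun a => by simp [hf])
  have hmean : periodMean M f = residueDensity S := by
    unfold periodMean residueDensity
    rw [smul_eq_mul, div_eq_inv_mul]
    congr 1
    have : ∑ i ∈ Finset.range M, f i = ∑ z : ZMod M, if z ∈ S then (1 : ℝ) else 0 := by
      refine Finset.sum_bij' (fun i _ => (i : ZMod M)) (fun z _ => z.val) ?_ ?_ ?_ ?_ ?_
      · simp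
      · exact fun z _ => Finset.mem_range.2 (ZMod.val_lt z)
      · exact fun i hi => ZMod.val_cast_of_lt (Finset.mem_range.1 hi)
      · exact fun z _ => ZMod.natCast_zmod_val z
      · simp [hf]
    rw [this, Set.ncard_eq_toFinset_card']
    simp [Finset.sum_boole]
  refine ⟨C, fun N => ?_⟩
  have h1 := (abs_le.1 (hC 1 N)).2
  rw [← sum_Icc_one_eq_sum_range, hmean, smul_eq_mul] at h1
  have h2 : (countUpTo {m : ℕ | (m : ZMod M) ∈ S} N : ℝ) = ∑ m ∈ Finset.Icc 1 N, f m := by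
    unfold countUpTo
    simp [hf, Finset.sum_boole]
  rw [h2]
  nlinarith [Nat.cast_nonneg (α := ℝ) N]

/-- `m ↦ m ^ l` is injective modulo `n`. -/
def PowInjMod (l n : ℕ) : Prop := ∀ a b : ℤ, (n : ℤ) ∣ a ^ l - b ^ l → (n : ℤ) ∣ a - b

theorem powInjMod_one_left (n : ℕ) : PowInjMod 1 n := fun a b h => by simpa using h

theorem powInjMod_of_injective {l n : ℕ} (h : Function.Injective fun m : ZMod n => m ^ l) :
    PowInjMod l n := by
  intro a b hab
  rw [← ZMod.intCast_zmod_eq_zero_iff_dvd] at hab ⊢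
  push_cast at hab ⊢
  rw [sub_eq_zero] at hab ⊢
  exact h hab

theorem PowInjMod.lcm {l n m : ℕ} (hn : PowInjMod l n) (hm : PowInjMod l m) :
    PowInjMod l (n.lcm m) := by
  intro a b hab
  have h1 : (n : ℤ) ∣ a - b := hn a b (dvd_trans (by exact_mod_cast Nat.dvd_lcm_left n m) hab)
  have h2 : (m : ℤ) ∣ a - b := hm a b (dvd_trans (by exact_mod_cast Nat.dvd_lcm_right n m) hab)
  exact Int.natCast_dvd.2 (Nat.lcm_dvd (Int.natCast_dvd.1 h1) (Int.natCast_dvd.1 h2))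

/-! ### Construction of the open sets -/

/-- The set `W` of positions left open at a stage of the construction, and its period `n`. -/
structure OpenStage (k l : ℕ) (H : Prop) where
  n : ℕ
  W : Set ℤ
  pos : 0 < n
  periodic : ∀ a j : ℤ, a + j * n ∈ W ↔ a ∈ W
  density : ∃ β < (1 / 4 : ℝ), DensityLE {m | (m : ℤ) ^ k ∉ W} β
  inj : H → PowInjMod l n

/-- The `r`-th powers, translated by any `h`, meet `W` with density at most `δ`, uniformly. -/
def UniformlySparse (r : ℕ) (W : Set ℤ) (δ : ℝ) : Prop :=
  ∃ C : ℝ, ∀ (h : ℤ) (N : ℕ), (countUpTo {m | (m : ℤ) ^ r + h ∈ W} N : ℝ) ≤ δ * N + C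

theorem UniformlySparse.mono {r : ℕ} {W W' : Set ℤ} {δ δ' : ℝ} (h : UniformlySparse r W δ)
    (hW : W' ⊆ W) (hδ : δ ≤ δ') : UniformlySparse r W' δ' := by
  obtain ⟨C, hC⟩ := h
  refine ⟨C, fun h N => ?_⟩
  have h1 : (countUpTo {m | (m : ℤ) ^ r + h ∈ W'} N : ℝ) ≤ countUpTo {m | (m : ℤ) ^ r + h ∈ W} N := by
    exact_mod_cast countUpTo_mono (fun m hm => hW hm) N
  have h2 : δ * N ≤ δ' * N := by gcongr
  linarith [hC h N]

/-- Uniformity in `h` holds because the additive constant depends only on `h` modulo `M`. -/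
theorem uniformlySparse_of_residueDensity_le {r M : ℕ} [NeZero M] {U : Set (ZMod M)} {δ : ℝ}
    (h : ∀ c, residueDensity {m : ZMod M | m ^ r + c ∈ U} ≤ δ) :
    UniformlySparse r {a | (a : ZMod M) ∈ U} δ := by
  choose C hC using fun c => densityLE_of_residueDensity_le (h c)
  obtain ⟨B, hB⟩ := Finite.bddAbove_range C
  refine ⟨B, fun h N => ?_⟩
  have h1 := hC (h : ZMod M) N
  have h2 : C (h : ZMod M) ≤ B := hB ⟨_, rfl⟩
  simp only [Set.mem_ofPred_eq] at h1 ⊢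
  push_cast
  linarith

/-- `fill` produces the oscillation along `k`-th powers; `sparse` serves regularity at `r = 1` and
convergence at `r = l`. -/
structure OpenStage.Step {k l : ℕ} {H : Prop} (t : ℕ) (s s' : OpenStage k l H) : Prop where
  dvd : s.n ∣ s'.n
  subset : s'.W ⊆ s.W
  fill : ∃ N ≥ t + 1, (countUpTo {m | (m : ℤ) ^ k ∉ s.W} N : ℝ) ≤ N / 4 ∧
    ∀ a : ℤ, |a| ≤ (N : ℤ) ^ k → a ∉ s'.W
  sparse : ∀ r, r = 1 ∨ r = l → UniformlySparse r s'.W (1 / (t + 1))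

theorem OpenStage.exists_step {k l : ℕ} (hk : 1 < k) (hl : 1 < l) (hkl : k ≠ l) (t : ℕ)
    (s : OpenStage k l (Odd l ∧ ∃ q : ℕ, q.Prime ∧ q ∣ k ∧ ¬ q ∣ l)) : ∃ s', s.Step t s' := by
  obtain ⟨β, hβ, C, hC⟩ := s.density
  obtain ⟨N, hNt, hN⟩ : ∃ N ≥ t + 1, (countUpTo {m | (m : ℤ) ^ k ∉ s.W} N : ℝ) ≤ N / 4 := by
    refine ⟨t + 1 + ⌈C / (1 / 4 - β)⌉₊, by omega, (hC _).trans ?_⟩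
    have h1 := Nat.le_ceil (C / (1 / 4 - β))
    rw [div_le_iff₀ (by linarith)] at h1
    push_cast
    nlinarith [(Nat.cast_nonneg t : (0 : ℝ) ≤ t)]
  set B : Finset ℤ := Finset.Icc (-(N : ℤ) ^ k) ((N : ℤ) ^ k) with hB
  -- The new stage loses the `k`-th powers outside `U` and those in the classes of `B`, in all `(1 +
  -- B.card) * ε`; this choice keeps the total below 1/4.
  set ε : ℝ := min ((1 / 4 - β) / (2 * (1 + B.card))) (1 / (t + 1)) with hε
  have hε0 : 0 < ε := by
    have : 0 < 1 / 4 - β := by linarith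
    positivity
  have hεB : (1 + B.card) * ε ≤ (1 / 4 - β) / 2 := by
    calc (1 + (B.card : ℝ)) * ε ≤ (1 + B.card) * ((1 / 4 - β) / (2 * (1 + B.card))) := by
          gcongr
          exact min_le_left _ _
      _ = _ := by field_simp
  obtain ⟨M, U, hM, hU⟩ := exists_isPowerSieve hk hl hkl hε0
  have : NeZero M := ⟨hM.ne'⟩
  have hper : ∀ a j : ℤ, ((a + j * (s.n.lcm M : ℕ) : ℤ) : ZMod M) = a := by
    intro a j
    obtain ⟨c, hc⟩ := Nat.dvd_lcm_right s.n M
    rw [hc]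
    push_cast
    simp
  let s' : OpenStage k l (Odd l ∧ ∃ q : ℕ, q.Prime ∧ q ∣ k ∧ ¬ q ∣ l) :=
    { n := s.n.lcm M
      -- Whole residue classes of the elements of `B` are closed, so that `W` stays periodic.
      W := {a | a ∈ s.W ∧ (a : ZMod M) ∈ U ∧ ∀ b ∈ B, (a : ZMod M) ≠ b}
      pos := Nat.lcm_pos s.pos hM
      periodic := by
        intro a j
        simp only [Set.mem_ofPred_eq, hper]
        obtain ⟨c, hc⟩ := Nat.dvd_lcm_left s.n M
        have : a + j * (s.n.lcm M : ℕ) = a + (j * c) * s.n := by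
          rw [hc]; push_cast; ring
        rw [this, s.periodic]
      density := by
        refine ⟨β + (1 + B.card) * ε, by linarith, ?_⟩
        have h1 := densityLE_of_residueDensity_le hU.compl_le
        have h2 : DensityLE (⋃ b ∈ B, {m : ℕ | (m : ZMod M) ∈ {m : ZMod M | m ^ k = b}})
            (B.card * ε) :=
          DensityLE.biUnion B fun b _ => densityLE_of_residueDensity_le (hU.fiber_le b)
        have h3 := DensityLE.union ⟨C, hC⟩ (h1.union h2)
        have e : β + (ε + B.card * ε) = β + (1 + B.card) * ε := by ring
        rw [e] at h3
        refine h3.mono fun m hm => ?_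
        by_contra hcon
        simp only [Set.mem_union, Set.mem_ofPred_eq, Set.mem_iUnion, not_or, not_not, not_exists] at hcon hm
        refine hm ⟨hcon.1, ?_, fun b hb => ?_⟩
        · push_cast; exact hcon.2.1
        · push_cast; exact hcon.2.2 b hb
      inj := fun h => (s.inj h).lcm (powInjMod_of_injective (hU.inj h)) }
  refine ⟨s', Nat.dvd_lcm_left _ _, fun a ha => ha.1, ⟨N, hNt, hN, ?_⟩, ?_⟩
  · intro a ha hW
    exact hW.2.2 a (Finset.mem_Icc.2 (abs_le.1 ha)) rfl
  · have hsub : s'.W ⊆ {a | (a : ZMod M) ∈ U} := fun a ha => ha.2.1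
    have hεt : ε ≤ 1 / (t + 1) := min_le_right _ _
    rintro r (rfl | rfl)
    · refine (uniformlySparse_of_residueDensity_le fun c => ?_).mono hsub hεt
      refine le_trans (le_of_eq ?_) (residueDensity_sieve_le hU)
      unfold residueDensity
      congr 2
      have : {m : ZMod M | m ^ 1 + c ∈ U} = Equiv.addRight c ⁻¹' U := by
        ext m; simp
      rw [this]
      exact Set.ncard_preimage_of_injective_subset_range (Equiv.addRight c).injective
        (by rw [(Equiv.addRight c).surjective.range_eq]; exact Set.subset_univ _)
    · exact (uniformlySparse_of_residueDensity_le hU.shift_le).mono hsub hεt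

/-- The nested sets of open positions of the construction. -/
structure IsSkeleton (k l : ℕ) (H : Prop) (n : ℕ → ℕ) (W : ℕ → Set ℤ) : Prop where
  pos : ∀ t, 0 < n t
  dvd : ∀ t, n t ∣ n (t + 1)
  periodic : ∀ t, ∀ a j : ℤ, a + j * n t ∈ W t ↔ a ∈ W t
  subset : ∀ t, W (t + 1) ⊆ W t
  fill : ∀ t, ∃ N ≥ t + 1, (countUpTo {m | (m : ℤ) ^ k ∉ W t} N : ℝ) ≤ N / 4 ∧
    ∀ a : ℤ, |a| ≤ (N : ℤ) ^ k → a ∉ W (t + 1)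
  sparse : ∀ t r, r = 1 ∨ r = l → UniformlySparse r (W (t + 1)) (1 / (t + 1))
  inj : H → ∀ t, PowInjMod l (n t)

theorem exists_isSkeleton {k l : ℕ} (hk : 1 < k) (hl : 1 < l) (hkl : k ≠ l) :
    ∃ n W, IsSkeleton k l (Odd l ∧ ∃ q : ℕ, q.Prime ∧ q ∣ k ∧ ¬ q ∣ l) n W := by
  choose f hf using OpenStage.exists_step hk hl hkl
  let s0 : OpenStage k l (Odd l ∧ ∃ q : ℕ, q.Prime ∧ q ∣ k ∧ ¬ q ∣ l) :=
    { n := 1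
      W := Set.univ
      pos := one_pos
      periodic := by simp
      density := ⟨0, by norm_num, by simpa using densityLE_empty⟩
      inj := fun _ a b _ => by simp }
  let S : ℕ → OpenStage k l (Odd l ∧ ∃ q : ℕ, q.Prime ∧ q ∣ k ∧ ¬ q ∣ l) :=
    fun t => Nat.rec s0 (fun t s => f t s) t
  have hS : ∀ t, (S t).Step t (S (t + 1)) := fun t => hf t (S t)
  exact ⟨fun t => (S t).n, fun t => (S t).W, fun t => (S t).pos, fun t => (hS t).dvd,
    fun t => (S t).periodic, fun t => (hS t).subset, fun t => (hS t).fill,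
    fun t => (hS t).sparse, fun h t => (S t).inj h⟩

/-! ### The Toeplitz word and its regularity -/

theorem hasDensity_of_periodic {n : ℕ} (hn : 0 < n) {A : Set ℤ} (hA : ∀ a : ℤ, a + n ∈ A ↔ a ∈ A) :
    HasDensity A (periodMean n (A.indicator (1 : ℤ → ℝ))) := by
  classical
  obtain ⟨C, hC⟩ := exists_norm_sum_sub_periodMean_le hn (f := A.indicator (1 : ℤ → ℝ))
    (fun a => by simp [Set.indicator_apply, hA])
  set d := periodMean n (A.indicator (1 : ℤ → ℝ))
  have hcard : ∀ N : ℕ, ((A ∩ Set.Icc (-(N : ℤ)) N).ncard : ℝ) =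
      ∑ i ∈ Finset.range (2 * N + 1), A.indicator (1 : ℤ → ℝ) (-N + i) := by
    intro N
    have h1 : A ∩ Set.Icc (-(N : ℤ)) N =
        (((Finset.range (2 * N + 1)).filter fun i : ℕ => (-(N : ℤ) + i) ∈ A).image
          fun i : ℕ => (-(N : ℤ) + i) : Finset ℤ) := by
      ext a
      simp only [Set.mem_inter_iff, Set.mem_Icc, Finset.coe_image, Finset.coe_filter,
        Finset.mem_range, Set.mem_image, Set.mem_ofPred_eq]
      constructor
      · rintro ⟨ha, h1, h2⟩
        have e : -(N : ℤ) + ((a + N).toNat : ℤ) = a := by omega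
        exact ⟨(a + N).toNat, ⟨by omega, by rwa [e]⟩, e⟩
      · rintro ⟨i, ⟨h1, h2⟩, rfl⟩
        exact ⟨h2, by omega, by omega⟩
    rw [h1, Set.ncard_coe_finset, Finset.card_image_of_injective _ fun i j hij => by
      simpa using hij]
    simp [Set.indicator_apply, Finset.sum_boole]
  unfold HasDensity
  simp_rw [hcard]
  rw [tendsto_iff_norm_sub_tendsto_zero]
  have hlim : Tendsto (fun N : ℕ => C / (2 * (N : ℝ) + 1)) atTop (𝓝 0) := by
    refine tendsto_const_nhds.div_atTop ?_
    exact tendsto_atTop_add_const_right _ _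
      (tendsto_natCast_atTop_atTop.const_mul_atTop (by norm_num))
  refine squeeze_zero (fun _ => norm_nonneg _) (fun N => ?_) hlim
  have hpos : (0 : ℝ) < 2 * N + 1 := by positivity
  have h2 := hC (-N) (2 * N + 1)
  push_cast at h2
  rw [le_div_iff₀ hpos]
  calc _ = ‖((∑ i ∈ Finset.range (2 * N + 1), A.indicator (1 : ℤ → ℝ) (-N + i)) /
        (2 * N + 1) - d) * (2 * N + 1)‖ := by
        rw [norm_mul, Real.norm_of_nonneg hpos.le]
    _ ≤ C := by
      rw [sub_mul, div_mul_cancel₀ _ hpos.ne', mul_comm d]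
      exact h2

theorem le_of_forall_nat_mul_le {a b C : ℝ} (h : ∀ N : ℕ, (N : ℝ) * a ≤ N * b + C) : a ≤ b := by
  by_contra hcon
  push Not at hcon
  obtain ⟨N, hN⟩ := exists_nat_gt (C / (a - b))
  rw [div_lt_iff₀ (by linarith)] at hN
  nlinarith [h N]

theorem periodMean_indicator_le_one {n : ℕ} (A : Set ℤ) :
    periodMean n (A.indicator (1 : ℤ → ℝ)) ≤ 1 := by
  unfold periodMean
  rw [smul_eq_mul]
  have : ∑ i ∈ Finset.range n, A.indicator (1 : ℤ → ℝ) i ≤ n := by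
    calc _ ≤ ∑ i ∈ Finset.range n, (1 : ℝ) :=
          Finset.sum_le_sum fun i _ => Set.indicator_le_self' (fun _ _ => zero_le_one) _
      _ = n := by simp
  rw [inv_mul_eq_div]
  exact div_le_one_of_le₀ this (Nat.cast_nonneg n)

theorem one_sub_le_periodMean_indicator {n : ℕ} (hn : 0 < n) {A W : Set ℤ}
    (hA : ∀ a : ℤ, a + n ∈ A ↔ a ∈ A) {δ : ℝ} (hW : UniformlySparse 1 W δ) (hAW : ∀ a, a ∈ A ∨ a ∈ W) :
    1 - δ ≤ periodMean n (A.indicator (1 : ℤ → ℝ)) := by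
  classical
  obtain ⟨C, hC⟩ := exists_norm_sum_sub_periodMean_le hn (f := A.indicator (1 : ℤ → ℝ))
    (fun a => by simp [Set.indicator_apply, hA])
  obtain ⟨C', hC'⟩ := hW
  refine le_of_forall_nat_mul_le (C := C + C') fun N => ?_
  have h1 := (abs_le.1 (hC 1 N)).2
  rw [← sum_Icc_one_eq_sum_range, smul_eq_mul] at h1
  have h2 := hC' 0 N
  have h3 : (N : ℝ) ≤ ∑ m ∈ Finset.Icc 1 N, A.indicator (1 : ℤ → ℝ) m +
      countUpTo {m | (m : ℤ) ^ 1 + 0 ∈ W} N := by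
    calc (N : ℝ) = ∑ m ∈ Finset.Icc 1 N, (1 : ℝ) := by simp
      _ ≤ ∑ m ∈ Finset.Icc 1 N, (A.indicator (1 : ℤ → ℝ) m + if (m : ℤ) ∈ W then 1 else 0) := by
          refine Finset.sum_le_sum fun m _ => ?_
          rcases hAW m with h | h
          · rw [Set.indicator_of_mem h]
            split_ifs <;> simp
          · rw [if_pos h]
            have := Set.indicator_nonneg (s := A) (f := (1 : ℤ → ℝ)) (fun _ _ => zero_le_one) m
            linarith
      _ = _ := by
          rw [Finset.sum_add_distrib]
          unfold countUpTo
          simp [Finset.sum_boole]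
  linarith

open Classical in
/-- The word that records the parity of the first stage at which a position is closed. -/
noncomputable def skeletonWord (W : ℕ → Set ℤ) : Word :=
  fun a => if Even (sInf {t | a ∉ W t}) then 0 else 1

namespace IsSkeleton

variable {k l : ℕ} {H : Prop} {n : ℕ → ℕ} {W : ℕ → Set ℤ}

theorem antitone (S : IsSkeleton k l H n W) : Antitone W := antitone_nat_of_succ_le S.subset

theorem dvd_of_le (S : IsSkeleton k l H n W) {s t : ℕ} (h : s ≤ t) : n s ∣ n t :=
  Nat.le_induction dvd_rfl (fun t _ ih => ih.trans (S.dvd t)) t h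

theorem mem_add_iff (S : IsSkeleton k l H n W) {s t : ℕ} (h : s ≤ t) (a j : ℤ) :
    a + j * n t ∈ W s ↔ a ∈ W s := by
  obtain ⟨c, hc⟩ := S.dvd_of_le h
  rw [hc]
  have : a + j * ((n s * c : ℕ) : ℤ) = a + (j * c) * n s := by push_cast; ring
  rw [this, S.periodic]

theorem exists_notMem (S : IsSkeleton k l H n W) (hk : 0 < k) (a : ℤ) : ∃ t, a ∉ W t := by
  obtain ⟨N, hN, -, h⟩ := S.fill a.natAbs
  refine ⟨_, h a ?_⟩
  have h1 : |a| ≤ N := by rw [Int.abs_eq_natAbs]; omega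
  exact h1.trans (by exact_mod_cast Nat.le_self_pow hk.ne' N)

/-- All `W s` with `s ≤ t` are `n t`-periodic, so a position closed by stage `t` and its translates
are closed at the same stage. -/
theorem sInf_add_eq (S : IsSkeleton k l H n W) {t : ℕ} {a : ℤ} (ha : a ∉ W t) (j : ℤ) :
    sInf {s | a + j * n t ∉ W s} = sInf {s | a ∉ W s} := by
  have hmem : a + j * n t ∉ W t := by rwa [S.mem_add_iff le_rfl]
  have h1 : sInf {s | a ∉ W s} ≤ t := Nat.sInf_le ha
  have h2 : sInf {s | a + j * n t ∉ W s} ≤ t := Nat.sInf_le hmem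
  have h3 : a ∉ W (sInf {s | a ∉ W s}) := Nat.sInf_mem (s := {s | a ∉ W s}) ⟨t, ha⟩
  have h4 : a + j * n t ∉ W (sInf {s | a + j * n t ∉ W s}) :=
    Nat.sInf_mem (s := {s | a + j * n t ∉ W s}) ⟨t, hmem⟩
  rw [S.mem_add_iff h2] at h4
  rw [← S.mem_add_iff h1 a j] at h3
  exact le_antisymm (Nat.sInf_le h3) (Nat.sInf_le h4)

theorem word_add (S : IsSkeleton k l H n W) {t : ℕ} {a : ℤ} (ha : a ∉ W t) (j : ℤ) :
    skeletonWord W (a + j * n t) = skeletonWord W a := by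
  unfold skeletonWord
  rw [S.sInf_add_eq ha]

theorem mem_per (S : IsSkeleton k l H n W) {t : ℕ} {a : ℤ} (ha : a ∉ W t) :
    a ∈ Per (n t) (skeletonWord W) := fun j => (S.word_add ha j).symm

theorem isToeplitz (S : IsSkeleton k l H n W) (hk : 0 < k) : IsToeplitz (skeletonWord W) := by
  intro a
  obtain ⟨t, ht⟩ := S.exists_notMem hk a
  exact ⟨n t, by exact_mod_cast S.pos t, S.mem_per ht⟩

theorem isPeriodStructure (S : IsSkeleton k l H n W) (hk : 0 < k) :
    IsPeriodStructure (skeletonWord W) n where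
  pos := S.pos
  dvd := S.dvd
  cover := Set.eq_univ_of_forall fun a => by
    obtain ⟨t, ht⟩ := S.exists_notMem hk a
    exact Set.mem_iUnion.2 ⟨t, S.mem_per ht⟩

theorem _root_.add_mul_mem_per {p q : ℕ} (h : p ∣ q) (x : Word) (a j : ℤ) (ha : a ∈ Per p x) :
    a + j * q ∈ Per p x := by
  obtain ⟨c, rfl⟩ := h
  intro i
  have h1 : a + j * ((p * c : ℕ) : ℤ) = a + (j * c) * p := by push_cast; ring
  have h2 : a + (j * c) * p + i * p = a + (j * c + i) * p := by ring
  rw [h1, h2, ← ha, ← ha]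

theorem isRegularToeplitz (S : IsSkeleton k l H n W) (hk : 0 < k) :
    IsRegularToeplitz (skeletonWord W) := by
  have hper : ∀ M : ℕ, ∀ a : ℤ, a + n M ∈ ⋃ t ≤ M, Per (n t) (skeletonWord W) ↔
      a ∈ ⋃ t ≤ M, Per (n t) (skeletonWord W) := by
    intro M a
    simp only [Set.mem_iUnion]
    constructor
    · rintro ⟨t, ht, h⟩
      refine ⟨t, ht, ?_⟩
      have := add_mul_mem_per (S.dvd_of_le ht) _ _ (-1) h
      simpa using this
    · rintro ⟨t, ht, h⟩
      refine ⟨t, ht, ?_⟩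
      have := add_mul_mem_per (S.dvd_of_le ht) _ _ 1 h
      simpa using this
  refine ⟨n, S.isPeriodStructure hk, _, fun M => hasDensity_of_periodic (S.pos M) (hper M), ?_⟩
  rw [← tendsto_add_atTop_iff_nat 1]
  have hlim : Tendsto (fun t : ℕ => 1 - 1 / ((t : ℝ) + 1)) atTop (𝓝 1) := by
    simpa using tendsto_const_nhds.sub tendsto_one_div_add_atTop_nhds_zero_nat (a := (1 : ℝ))
  refine tendsto_of_tendsto_of_tendsto_of_le_of_le hlim tendsto_const_nhds (fun t => ?_)
    fun t => periodMean_indicator_le_one _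
  refine one_sub_le_periodMean_indicator (S.pos _) (hper _) (S.sparse t 1 (Or.inl rfl)) fun a => ?_
  by_cases ha : a ∈ W (t + 1)
  · exact Or.inr ha
  · exact Or.inl (Set.mem_iUnion₂.2 ⟨t + 1, le_rfl, S.mem_per ha⟩)

/-- For a shift of the word, `h` can be reduced modulo `n t`. Finitely many `h` therefore suffice,
and the condition becomes a finite union of closed sets containing the orbit. -/
theorem exists_shift_of_mem_orbitClosure (S : IsSkeleton k l H n W) (t : ℕ) {y : Word}
    (hy : y ∈ orbitClosure (skeletonWord W)) :
    ∃ h : ℤ, ∀ a, a + h ∉ W t → y a = skeletonWord W (a + h) := by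
  set C : Set Word := ⋃ h ∈ Finset.range (n t),
    {y | ∀ a, a + (h : ℤ) ∉ W t → y a = skeletonWord W (a + h)} with hC
  have hclosed : IsClosed C := by
    refine Set.Finite.isClosed_biUnion (Finset.finite_toSet _) fun h _ => ?_
    have : {y : Word | ∀ a, a + (h : ℤ) ∉ W t → y a = skeletonWord W (a + h)} =
        ⋂ a, ⋂ (_ : a + (h : ℤ) ∉ W t), {y | y a = skeletonWord W (a + h)} := by
      ext y; simp
    rw [this]
    exact isClosed_iInter fun a => isClosed_iInter fun _ =>
      isClosed_eq (continuous_apply a) continuous_const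
  have hsub : orbitClosure (skeletonWord W) ⊆ C := by
    refine closure_minimal ?_ hclosed
    rintro _ ⟨j, rfl⟩
    have hn : (0 : ℤ) < n t := by exact_mod_cast S.pos t
    have h0 := Int.emod_nonneg j hn.ne'
    have h1 := Int.emod_lt_of_pos j hn
    have h2 := Int.emod_add_mul_ediv j (n t)
    refine Set.mem_biUnion (x := (j % n t).toNat) (by simp; omega) fun a ha => ?_
    rw [Int.toNat_of_nonneg h0] at ha ⊢
    have h3 : a + j % n t + j / n t * n t = a + j := by linarith
    have h4 := S.word_add ha (j / n t)
    rwa [h3] at h4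
  obtain ⟨h, -, hh⟩ := Set.mem_iUnion₂.1 (hsub hy)
  exact ⟨h, hh⟩

end IsSkeleton

/-! ### Convergence of averages on the orbit closure -/

instance compactSpace_orbitClosure (x : Word) : CompactSpace (orbitClosure x) :=
  isCompact_iff_compactSpace.1 isClosed_closure.isCompact

theorem exists_window {x : Word} {F : orbitClosure x → ℂ} (hF : Continuous F) {η : ℝ}
    (hη : 0 < η) : ∃ I : Finset ℤ, ∀ y y' : orbitClosure x,
      (∀ i ∈ I, y.1 i = y'.1 i) → ‖F y - F y'‖ < η := by
  have hK : IsCompact {q : orbitClosure x × orbitClosure x | η ≤ ‖F q.1 - F q.2‖} :=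
    (isClosed_le continuous_const (by fun_prop)).isCompact
  obtain ⟨I, hI⟩ := IsCompact.elim_finite_subfamily_closed hK
    (fun i : ℤ => {q : orbitClosure x × orbitClosure x | q.1.1 i = q.2.1 i})
    (fun i => isClosed_eq
      ((continuous_apply i).comp (continuous_subtype_val.comp continuous_fst))
      ((continuous_apply i).comp (continuous_subtype_val.comp continuous_snd))) (by
      refine Set.eq_empty_of_forall_notMem fun q ⟨h1, h2⟩ => ?_
      have : q.1 = q.2 := Subtype.ext (funext fun i => Set.mem_iInter.1 h2 i)
      simp only [Set.mem_ofPred_eq, this, sub_self, norm_zero] at h1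
      exact absurd hη (not_lt.2 h1))
  refine ⟨I, fun y y' h => ?_⟩
  by_contra hcon
  have : (y, y') ∈ (∅ : Set (orbitClosure x × orbitClosure x)) :=
    hI ▸ ⟨not_lt.1 hcon, Set.mem_iInter₂.2 h⟩
  exact this

theorem exists_norm_le {x : Word} {F : orbitClosure x → ℂ} (hF : Continuous F) :
    ∃ B : ℝ, 0 ≤ B ∧ ∀ y, ‖F y‖ ≤ B := by
  obtain ⟨B, hB⟩ := (isCompact_range hF).isBounded.exists_norm_le
  exact ⟨B, (norm_nonneg _).trans (hB _ ⟨basePoint x, rfl⟩), fun y => hB _ ⟨y, rfl⟩⟩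

/-- The values of `F` along the orbit of the base point, read off modulo `n`. -/
def orbitModel (x : Word) (n : ℕ) (F : orbitClosure x → ℂ) (a : ℤ) : ℂ :=
  F (sigma x (a % n) (basePoint x))

theorem countUpTo_eq_sum_indicator (A : Set ℕ) (N : ℕ) :
    (countUpTo A N : ℝ) = ∑ m ∈ Finset.Icc 1 N, A.indicator 1 m := by
  classical
  unfold countUpTo
  simp [Set.indicator_apply, Finset.sum_boole]

namespace IsSkeleton

variable {k l : ℕ} {H : Prop} {n : ℕ → ℕ} {W : ℕ → Set ℤ}

/-- Up to `η / 2`, `F` sees only a finite window `I`. If the window at `m ^ r + h` avoids the open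
set, the value can be read off modulo the period; the other `m` have density at most `I.card / (t +
1)` and cost `2 * B` each. -/
theorem exists_sum_approx (S : IsSkeleton k l H n W) {r : ℕ} (hr : r = 1 ∨ r = l)
    {F : orbitClosure (skeletonWord W) → ℂ} (hF : Continuous F) {η : ℝ} (hη : 0 < η) :
    ∃ T, ∀ t ≥ T, ∀ y, ∃ h : ℤ, ∃ C : ℝ, ∀ N : ℕ,
      ‖∑ m ∈ Finset.Icc 1 N, F (sigma (skeletonWord W) ((m : ℤ) ^ r) y) -
        (N : ℝ) • periodMean (n t) (fun a => orbitModel (skeletonWord W) (n t) F (a ^ r + h))‖ ≤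
      η * N + C := by
  classical
  obtain ⟨I, hI⟩ := exists_window hF (half_pos hη)
  obtain ⟨B, hB0, hB⟩ := exists_norm_le hF
  obtain ⟨T, hT⟩ := exists_nat_gt (4 * B * I.card / η)
  refine ⟨T + 1, fun t ht y => ?_⟩
  obtain ⟨t, rfl⟩ : ∃ t', t = t' + 1 := ⟨t - 1, by omega⟩
  have htT : 4 * B * I.card ≤ η * (t + 1) := by
    rw [div_lt_iff₀ hη] at hT
    have : (T : ℝ) ≤ t := by exact_mod_cast (by omega : T ≤ t)
    nlinarith
  obtain ⟨h, hh⟩ := S.exists_shift_of_mem_orbitClosure (t + 1) y.2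
  set G : ℤ → ℂ := fun a => orbitModel (skeletonWord W) (n (t + 1)) F (a ^ r + h) with hG
  have hGper : ∀ a, G (a + n (t + 1)) = G a := by
    intro a
    have : ((a + n (t + 1)) ^ r + h) % (n (t + 1) : ℤ) = (a ^ r + h) % n (t + 1) := by
      have h1 : (a + n (t + 1)) ≡ a [ZMOD n (t + 1)] := Int.add_modEq_right
      exact (h1.pow r).add_right h
    simp only [hG, orbitModel, this]
  obtain ⟨C, hC⟩ := exists_norm_sum_sub_periodMean_le (S.pos (t + 1)) hGper
  obtain ⟨D, hD⟩ := S.sparse t r hr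
  set bad : Set ℕ := {m | ∃ i ∈ I, (m : ℤ) ^ r + (i + h) ∈ W (t + 1)} with hbad
  have hbadN : ∀ N, (countUpTo bad N : ℝ) ≤ I.card * (1 / (t + 1) * N + D) := by
    intro N
    have : countUpTo bad N ≤ ∑ i ∈ I, countUpTo {m | (m : ℤ) ^ r + (i + h) ∈ W (t + 1)} N := by
      unfold countUpTo
      refine le_trans (Finset.card_le_card ?_) Finset.card_biUnion_le
      intro m hm
      simp only [hbad, Finset.mem_filter, Finset.mem_biUnion, Set.mem_ofPred_eq] at hm ⊢
      obtain ⟨h1, i, h2, h3⟩ := hm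
      exact ⟨i, h2, h1, h3⟩
    calc (countUpTo bad N : ℝ) ≤
          ∑ i ∈ I, (countUpTo {m | (m : ℤ) ^ r + (i + h) ∈ W (t + 1)} N : ℝ) := by
          exact_mod_cast this
      _ ≤ ∑ i ∈ I, (1 / (t + 1) * N + D) := Finset.sum_le_sum fun i _ => hD _ _
      _ = _ := by rw [Finset.sum_const, nsmul_eq_mul]
  have hpt : ∀ m : ℕ, ‖F (sigma (skeletonWord W) ((m : ℤ) ^ r) y) - G m‖ ≤
      η / 2 + 2 * B * bad.indicator 1 m := by
    intro m
    by_cases hm : m ∈ bad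
    · rw [Set.indicator_of_mem hm, Pi.one_apply]
      calc _ ≤ ‖F (sigma (skeletonWord W) ((m : ℤ) ^ r) y)‖ + ‖G m‖ := norm_sub_le _ _
        _ ≤ B + B := add_le_add (hB _) (hB _)
        _ ≤ _ := by linarith
    · rw [Set.indicator_of_notMem hm, mul_zero, add_zero]
      refine (hI _ _ fun i hi => ?_).le
      have hi' : i + (m : ℤ) ^ r + h ∉ W (t + 1) := fun hcon => hm ⟨i, hi, by
        rwa [show (m : ℤ) ^ r + (i + h) = i + (m : ℤ) ^ r + h by ring]⟩
      have h1 := hh _ hi'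
      have h2 := S.word_add hi' (-(((m : ℤ) ^ r + h) / n (t + 1)))
      have h3 := Int.emod_add_mul_ediv ((m : ℤ) ^ r + h) (n (t + 1))
      change y.1 (i + (m : ℤ) ^ r) = skeletonWord W (i + ((m : ℤ) ^ r + h) % n (t + 1))
      rw [h1, ← h2]
      congr 1
      linarith
  refine ⟨h, C + 2 * B * I.card * D, fun N => ?_⟩
  have h1 := hC 1 N
  rw [← sum_Icc_one_eq_sum_range] at h1
  have h2 : ‖∑ m ∈ Finset.Icc 1 N, F (sigma (skeletonWord W) ((m : ℤ) ^ r) y) - ∑ m ∈ Finset.Icc 1 N, G m‖ ≤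
      N * (η / 2) + 2 * B * countUpTo bad N := by
    rw [← Finset.sum_sub_distrib]
    refine (norm_sum_le_of_le _ fun m _ => hpt m).trans (le_of_eq ?_)
    rw [Finset.sum_add_distrib, ← Finset.mul_sum, ← countUpTo_eq_sum_indicator]
    simp
  have h4 : 2 * B * countUpTo bad N ≤ η / 2 * N + 2 * B * I.card * D := by
    have ht0 : (0 : ℝ) < t + 1 := by positivity
    have h5 : 2 * B * I.card * (1 / (t + 1)) ≤ η / 2 := by
      rw [mul_one_div, div_le_iff₀ ht0]
      linarith
    calc 2 * B * countUpTo bad N ≤ 2 * B * (I.card * (1 / (t + 1) * N + D)) := by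
          gcongr
          exact hbadN N
      _ = 2 * B * I.card * (1 / (t + 1)) * N + 2 * B * I.card * D := by ring
      _ ≤ _ := by gcongr
  calc _ ≤ ‖∑ m ∈ Finset.Icc 1 N, F (sigma (skeletonWord W) ((m : ℤ) ^ r) y) - ∑ m ∈ Finset.Icc 1 N, G m‖ +
        ‖∑ m ∈ Finset.Icc 1 N, G m - (N : ℝ) • periodMean (n (t + 1)) G‖ :=
        norm_sub_le_norm_sub_add_norm_sub _ _ _
    _ ≤ _ := by linarith

theorem exists_average_approx (S : IsSkeleton k l H n W) {r : ℕ} (hr : r = 1 ∨ r = l)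
    {F : orbitClosure (skeletonWord W) → ℂ} (hF : Continuous F) {η : ℝ} (hη : 0 < η) :
    ∃ T, ∀ t ≥ T, ∀ y, ∃ h : ℤ, ∀ᶠ N in atTop,
      ‖powerAverage (skeletonWord W) r F y N -
        periodMean (n t) (fun a => orbitModel (skeletonWord W) (n t) F (a ^ r + h))‖ ≤ η := by
  obtain ⟨T, hT⟩ := S.exists_sum_approx hr hF (half_pos hη)
  refine ⟨T, fun t ht y => ?_⟩
  obtain ⟨h, C, hC⟩ := hT t ht y
  refine ⟨h, ?_⟩
  filter_upwards [eventually_ge_atTop (⌈C / (η / 2)⌉₊ + 1)] with N hN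
  have hN0 : (0 : ℝ) < N := by exact_mod_cast (by omega : 0 < N)
  have hCN : C ≤ η / 2 * N := by
    rw [← div_le_iff₀' (half_pos hη)]
    exact (Nat.le_ceil _).trans (by exact_mod_cast (by omega : ⌈C / (η / 2)⌉₊ ≤ N))
  set c := periodMean (n t) (fun a => orbitModel (skeletonWord W) (n t) F (a ^ r + h))
  have hNc : (N : ℂ) ≠ 0 := by exact_mod_cast hN0.ne'
  have e : powerAverage (skeletonWord W) r F y N - c = (1 / (N : ℂ)) *
      (∑ m ∈ Finset.Icc 1 N, F (sigma (skeletonWord W) ((m : ℤ) ^ r) y) - (N : ℝ) • c) := by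
    unfold powerAverage
    rw [mul_sub, Complex.real_smul]
    push_cast
    rw [← mul_assoc, one_div_mul_cancel hNc, one_mul]
  rw [e, norm_mul, norm_div, norm_one, Complex.norm_natCast, one_div_mul_eq_div, div_le_iff₀ hN0]
  linarith [hC N]

theorem exists_tendsto_powerAverage (S : IsSkeleton k l H n W) {r : ℕ} (hr : r = 1 ∨ r = l)
    {F : orbitClosure (skeletonWord W) → ℂ} (hF : Continuous F) (y) :
    ∃ L : ℂ, Tendsto (powerAverage (skeletonWord W) r F y) atTop (𝓝 L) := by
  apply cauchySeq_tendsto_of_complete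
  rw [Metric.cauchySeq_iff']
  intro ε hε
  obtain ⟨T, hT⟩ := S.exists_average_approx hr hF (by linarith : 0 < ε / 3)
  obtain ⟨h, hh⟩ := hT T le_rfl y
  obtain ⟨N, hN⟩ := eventually_atTop.1 hh
  refine ⟨N, fun m hm => ?_⟩
  rw [dist_eq_norm]
  have h1 := hN m hm
  have h2 := hN N le_rfl
  rw [norm_sub_rev] at h2
  refine (norm_sub_le_norm_sub_add_norm_sub _ _ _).trans_lt (lt_of_le_of_lt (add_le_add h1 h2) ?_)
  linarith

/-- The map `a ↦ a ^ r + h` permutes the residues modulo `N`. -/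
theorem periodMean_pow_add {N : ℕ} (hN : 0 < N) {r : ℕ} (hr : PowInjMod r N) (h : ℤ) (x : Word)
    (F : orbitClosure x → ℂ) :
    periodMean N (fun a => orbitModel x N F (a ^ r + h)) = periodMean N (orbitModel x N F) := by
  unfold periodMean
  congr 1
  have hN' : (0 : ℤ) < N := by exact_mod_cast hN
  have hmaps : ∀ i ∈ Finset.range N, (((i : ℤ) ^ r + h) % N).toNat ∈ Finset.range N := by
    intro i _
    have h1 := Int.emod_lt_of_pos ((i : ℤ) ^ r + h) hN'
    rw [Finset.mem_range]
    omega
  have hinj : Set.InjOn (fun i : ℕ => (((i : ℤ) ^ r + h) % N).toNat) (Finset.range N) := by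
    intro i hi j hj hij
    have h1 := Int.emod_nonneg ((i : ℤ) ^ r + h) hN'.ne'
    have h2 := Int.emod_nonneg ((j : ℤ) ^ r + h) hN'.ne'
    have h3 : ((j : ℤ) ^ r + h) % N = ((i : ℤ) ^ r + h) % N := by
      simp only at hij
      omega
    have h4 := hr i j (by
      have := Int.ModEq.dvd (n := (N : ℤ)) h3
      simpa using this)
    simp only [Finset.coe_range, Set.mem_Iio] at hi hj
    have h5 := Int.eq_zero_of_abs_lt_dvd h4 (abs_lt.2 ⟨by omega, by omega⟩)
    omega
  refine Finset.sum_nbij (fun i : ℕ => (((i : ℤ) ^ r + h) % N).toNat) hmaps hinj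
    (Finset.surjOn_of_injOn_of_card_le _ hmaps hinj le_rfl) fun i _ => ?_
  have h1 := Int.emod_nonneg ((i : ℤ) ^ r + h) hN'.ne'
  simp only [orbitModel]
  rw [Int.toNat_of_nonneg h1, Int.emod_emod]

/-- When `l`-th powers are equidistributed modulo every `n t`, all averages share one limit. -/
theorem exists_common_limit (S : IsSkeleton k l H n W) (hH : H)
    {F : orbitClosure (skeletonWord W) → ℂ} (hF : Continuous F) :
    ∃ L : ℂ, ∀ r, r = 1 ∨ r = l → ∀ y,
      Tendsto (powerAverage (skeletonWord W) r F y) atTop (𝓝 L) := by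
  set b := basePoint (skeletonWord W)
  obtain ⟨L, hL⟩ := S.exists_tendsto_powerAverage (Or.inl rfl) hF b
  refine ⟨L, fun r hr y => ?_⟩
  obtain ⟨L', hL'⟩ := S.exists_tendsto_powerAverage hr hF y
  suffices L' = L by rwa [this] at hL'
  refine eq_of_forall_dist_le fun ε hε => ?_
  obtain ⟨T, hT⟩ := S.exists_average_approx hr hF (half_pos hε)
  obtain ⟨T', hT'⟩ := S.exists_average_approx (Or.inl rfl) hF (half_pos hε)
  have hinj : PowInjMod r (n (max T T')) := by
    rcases hr with rfl | rfl
    · exact powInjMod_one_left _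
    · exact S.inj hH _
  -- At a common stage both averages are compared with the same mean `c`, which no longer involves
  -- `r`, `h` or the point.
  obtain ⟨h, hh⟩ := hT (max T T') (le_max_left _ _) y
  obtain ⟨h', hh'⟩ := hT' (max T T') (le_max_right _ _) b
  rw [periodMean_pow_add (S.pos _) hinj] at hh
  rw [periodMean_pow_add (S.pos _) (powInjMod_one_left _)] at hh'
  set c := periodMean (n (max T T')) (orbitModel (skeletonWord W) (n (max T T')) F)
  have h1 : ‖L' - c‖ ≤ ε / 2 := le_of_tendsto (hL'.sub_const c).norm hh
  have h2 : ‖L - c‖ ≤ ε / 2 := le_of_tendsto (hL.sub_const c).norm hh'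
  rw [norm_sub_rev] at h2
  rw [dist_eq_norm]
  exact (norm_sub_le_norm_sub_add_norm_sub _ _ _).trans (by linarith)

/-! ### Oscillation along `k`-th powers -/

theorem sInf_notMem_eq (S : IsSkeleton k l H n W) {t : ℕ} {a : ℤ} (h : a ∈ W t)
    (h' : a ∉ W (t + 1)) : sInf {s | a ∉ W s} = t + 1 := by
  refine le_antisymm (Nat.sInf_le h') ?_
  by_contra hcon
  have h1 : a ∉ W (sInf {s | a ∉ W s}) := Nat.sInf_mem (s := {s | a ∉ W s}) ⟨_, h'⟩
  exact h1 (S.antitone (by omega) h)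

/-- Powers open at stage `t` but closed at `t + 1` have the sign `(-1) ^ (t + 1)`. At most `N / 4`
others deviate, by at most 2 each, whence 1/2. -/
theorem norm_powerAverage_sub_le (S : IsSkeleton k l H n W) (t : ℕ) :
    ∃ N ≥ t + 1, ‖powerAverage (skeletonWord W) k (signZero (skeletonWord W))
      (basePoint (skeletonWord W)) N - (-1) ^ (t + 1)‖ ≤ 1 / 2 := by
  classical
  obtain ⟨N, hN, hcount, hfill⟩ := S.fill t
  refine ⟨N, hN, ?_⟩
  set x := skeletonWord W
  have hN0 : (0 : ℝ) < N := by exact_mod_cast (by omega : 0 < N)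
  have hNc : (N : ℂ) ≠ 0 := by exact_mod_cast hN0.ne'
  have hval : ∀ m ∈ Finset.Icc 1 N, ‖signZero x (sigma x ((m : ℤ) ^ k) (basePoint x)) -
      (-1) ^ (t + 1)‖ ≤ 2 * Set.indicator {m : ℕ | (m : ℤ) ^ k ∉ W t} 1 m := by
    intro m hm
    rw [Finset.mem_Icc] at hm
    by_cases hW : m ∈ {m : ℕ | (m : ℤ) ^ k ∉ W t}
    · rw [Set.indicator_of_mem hW, Pi.one_apply]
      have h1 : ‖signZero x (sigma x ((m : ℤ) ^ k) (basePoint x))‖ = 1 := by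
        simp [signZero]
      refine (norm_sub_le _ _).trans ?_
      rw [h1]
      norm_num
    · have hW' : (m : ℤ) ^ k ∈ W t := by simpa using hW
      have hlast : (m : ℤ) ^ k ∉ W (t + 1) := hfill _ (by
        rw [abs_of_nonneg (by positivity)]
        exact_mod_cast Nat.pow_le_pow_left hm.2 k)
      have hx : signZero x (sigma x ((m : ℤ) ^ k) (basePoint x)) = (-1) ^ (t + 1) := by
        have : (sigma x ((m : ℤ) ^ k) (basePoint x)).1 0 =
            if Even (t + 1) then (0 : Fin 2) else 1 := by
          change skeletonWord W (0 + (m : ℤ) ^ k) = _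
          rw [zero_add]
          unfold skeletonWord
          rw [S.sInf_notMem_eq hW' hlast]
        unfold signZero
        rw [this]
        split_ifs with he
        · simp [he.neg_one_pow]
        · simp [(Nat.not_even_iff_odd.1 he).neg_one_pow]
      rw [hx, Set.indicator_of_notMem hW]
      simp
  have e : powerAverage x k (signZero x) (basePoint x) N - (-1) ^ (t + 1) = (1 / (N : ℂ)) *
      ∑ m ∈ Finset.Icc 1 N, (signZero x (sigma x ((m : ℤ) ^ k) (basePoint x)) -
        (-1) ^ (t + 1)) := by
    unfold powerAverage
    rw [Finset.sum_sub_distrib, mul_sub, Finset.sum_const, Nat.card_Icc, nsmul_eq_mul,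
      Nat.add_sub_cancel, ← mul_assoc, one_div_mul_cancel hNc, one_mul]
  rw [e, norm_mul, norm_div, norm_one, Complex.norm_natCast, one_div_mul_eq_div, div_le_iff₀ hN0]
  refine (norm_sum_le_of_le _ hval).trans ?_
  rw [← Finset.mul_sum, ← countUpTo_eq_sum_indicator]
  linarith

theorem not_tendsto_powerAverage (S : IsSkeleton k l H n W) :
    ¬ ∃ L : ℂ, Tendsto (powerAverage (skeletonWord W) k (signZero (skeletonWord W))
      (basePoint (skeletonWord W))) atTop (𝓝 L) := by
  rintro ⟨L, hL⟩
  obtain ⟨T, hT⟩ := Metric.tendsto_atTop.1 hL (1 / 4) (by norm_num)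
  have key : ∀ t ≥ T, ‖L - (-1) ^ (t + 1)‖ < 1 := by
    intro t ht
    obtain ⟨N, hN, h⟩ := S.norm_powerAverage_sub_le t
    have h1 := hT N (by omega)
    rw [dist_comm, dist_eq_norm] at h1
    refine (norm_sub_le_norm_sub_add_norm_sub _ _ _).trans_lt (add_lt_add_of_lt_of_le h1 h) |>.trans ?_
    norm_num
  have h1 := key (2 * T) (by omega)
  have h2 := key (2 * T + 1) (by omega)
  rw [(Odd.neg_one_pow ⟨T, rfl⟩ : (-1 : ℂ) ^ (2 * T + 1) = -1)] at h1
  rw [show 2 * T + 1 + 1 = 2 * (T + 1) by ring, pow_mul] at h2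
  norm_num at h2
  have h3 : ‖(2 : ℂ)‖ ≤ ‖L - -1‖ + ‖L - 1‖ := by
    have : (2 : ℂ) = (L - -1) - (L - 1) := by ring
    rw [this]
    exact norm_sub_le _ _
  norm_num at h3 h1
  linarith

end IsSkeleton

/-! ### Existence and uniqueness of the invariant measure -/

section UniqueErgodicity

variable {x : Word}

theorem continuous_orbitClosure_sigma (j : ℤ) : Continuous (sigma x j) :=
  ((continuous_shift j).comp continuous_subtype_val).subtype_mk _

theorem sigma_add (i j : ℤ) (y : orbitClosure x) : sigma x (i + j) y = sigma x i (sigma x j y) :=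
  Subtype.ext (shift_add i j y.1)

theorem iterate_sigma_one (m : ℕ) : (sigma x 1)^[m] = sigma x m := by
  induction m with
  | zero => funext y; exact Subtype.ext (shift_zero y.1).symm
  | succ m ih =>
    funext y
    rw [Function.iterate_succ_apply', ih, ← sigma_add]
    congr 1
    push_cast
    ring

theorem measurePreserving_sigma {ν : Measure (orbitClosure x)} (hν : IsInvariantProbability x ν)
    (m : ℕ) : MeasurePreserving (sigma x m) ν ν := by
  rw [← iterate_sigma_one]
  exact hν.2.iterate m

/-- If the averages of `F` converge to `L` at every point, `F` has integral `L`. -/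
theorem integral_eq_of_tendsto {ν : Measure (orbitClosure x)} (hν : IsInvariantProbability x ν)
    {F : orbitClosure x → ℂ} (hF : Continuous F) {L : ℂ}
    (hL : ∀ y, Tendsto (powerAverage x 1 F y) atTop (𝓝 L)) : ∫ y, F y ∂ν = L := by
  have : IsProbabilityMeasure ν := hν.1
  obtain ⟨B, hB0, hB⟩ := exists_norm_le hF
  have hcont : ∀ m : ℤ, Continuous fun y => F (sigma x m y) := fun m => hF.comp (continuous_orbitClosure_sigma m)
  have hint : ∀ m : ℤ, Integrable (fun y => F (sigma x m y)) ν := fun m =>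
    Integrable.of_bound (hcont m).aestronglyMeasurable B (Eventually.of_forall fun y => hB _)
  have h1 : Tendsto (fun N => ∫ y, powerAverage x 1 F y N ∂ν) atTop (𝓝 (∫ _, L ∂ν)) := by
    refine tendsto_integral_of_dominated_convergence (fun _ => B) (fun N => ?_)
      (integrable_const B) (fun N => Eventually.of_forall fun y => ?_)
      (Eventually.of_forall fun y => hL y)
    · have : Continuous fun y => powerAverage x 1 F y N :=
        continuous_const.mul (continuous_finsetSum _ fun m _ => hcont _)
      exact this.aestronglyMeasurable
    · unfold powerAverage
      rw [norm_mul, norm_div, norm_one, Complex.norm_natCast, one_div_mul_eq_div]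
      refine div_le_of_le_mul₀ (Nat.cast_nonneg N) hB0 ?_
      refine (norm_sum_le_of_le _ fun m _ => hB _).trans (le_of_eq ?_)
      simp [mul_comm]
  have h2 : (fun N => ∫ y, powerAverage x 1 F y N ∂ν) =ᶠ[atTop] fun _ => ∫ y, F y ∂ν := by
    filter_upwards [eventually_ge_atTop 1] with N hN
    have hNc : (N : ℂ) ≠ 0 := by exact_mod_cast (by omega : N ≠ 0)
    unfold powerAverage
    rw [integral_const_mul, integral_finsetSum _ fun m _ => hint _]
    have : ∀ m ∈ Finset.Icc 1 N, ∫ y, F (sigma x ((m : ℤ) ^ 1) y) ∂ν = ∫ y, F y ∂ν := by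
      intro m _
      rw [pow_one]
      have hmp := measurePreserving_sigma hν m
      rw [← integral_map hmp.measurable.aemeasurable
        (hF.aestronglyMeasurable (μ := Measure.map (sigma x m) ν)), hmp.map_eq]
    rw [Finset.sum_congr rfl this, Finset.sum_const, Nat.card_Icc, nsmul_eq_mul,
      Nat.add_sub_cancel, ← mul_assoc, one_div_mul_cancel hNc, one_mul]
  have h3 := tendsto_nhds_unique h1 ((tendsto_congr' h2).2 tendsto_const_nhds)
  simpa using h3.symm

theorem ext_of_isInvariantProbability {μ ν : Measure (orbitClosure x)}
    (hμ : IsInvariantProbability x μ) (hν : IsInvariantProbability x ν)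
    (h : ∀ F : orbitClosure x → ℂ, Continuous F → ∃ L : ℂ, ∀ y,
      Tendsto (powerAverage x 1 F y) atTop (𝓝 L)) : ν = μ := by
  have : IsProbabilityMeasure μ := hμ.1
  have : IsProbabilityMeasure ν := hν.1
  refine ext_of_forall_integral_eq_of_IsFiniteMeasure fun f => ?_
  have hf : Continuous fun y => (f y : ℂ) := Complex.continuous_ofReal.comp f.continuous
  obtain ⟨L, hL⟩ := h _ hf
  have h1 := integral_eq_of_tendsto hμ hf hL
  have h2 := integral_eq_of_tendsto hν hf hL
  rw [integral_complex_ofReal] at h1 h2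
  exact Complex.ofReal_injective (h2.trans h1.symm)

/-- The common limit is a positive normalized linear functional, represented by a measure through
the Riesz theorem. -/
theorem exists_isInvariantProbability
    (h : ∀ F : orbitClosure x → ℂ, Continuous F → ∃ L : ℂ, ∀ y,
      Tendsto (powerAverage x 1 F y) atTop (𝓝 L)) : ∃ μ, IsInvariantProbability x μ := by
  let A : (orbitClosure x → ℝ) → orbitClosure x → ℕ → ℝ := fun f y N =>
    (1 / (N : ℝ)) * ∑ m ∈ Finset.Icc 1 N, f (sigma x m y)
  have hA : ∀ f : orbitClosure x → ℝ, Continuous f → ∃ L : ℝ, ∀ y,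
      Tendsto (A f y) atTop (𝓝 L) := by
    intro f hf
    obtain ⟨L, hL⟩ := h (fun y => (f y : ℂ)) (Complex.continuous_ofReal.comp hf)
    refine ⟨L.re, fun y => ?_⟩
    have := (Complex.continuous_re.tendsto L).comp (hL y)
    refine this.congr fun N => ?_
    have e : powerAverage x 1 (fun y => (f y : ℂ)) y N = (A f y N : ℝ) := by
      simp [powerAverage, A]
    simp only [Function.comp, e, Complex.ofReal_re]
  choose L hL using fun f : CompactlySupportedContinuousMap (orbitClosure x) ℝ => hA f f.continuous
  set b := basePoint x
  let Λ₀ : CompactlySupportedContinuousMap (orbitClosure x) ℝ →ₗ[ℝ] ℝ :=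
    { toFun := L
      map_add' := fun f g => by
        refine tendsto_nhds_unique (hL (f + g) b) (((hL f b).add (hL g b)).congr fun N => ?_)
        simp only [A, CompactlySupportedContinuousMap.coe_add, Pi.add_apply,
          Finset.sum_add_distrib, mul_add]
      map_smul' := fun c f => by
        refine tendsto_nhds_unique (hL (c • f) b) (((hL f b).const_mul c).congr fun N => ?_)
        simp only [A, CompactlySupportedContinuousMap.coe_smul, Pi.smul_apply, smul_eq_mul,
          ← Finset.mul_sum]
        ring }
  let Λ : CompactlySupportedContinuousMap (orbitClosure x) ℝ →ₚ[ℝ] ℝ :=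
    PositiveLinearMap.mk₀ Λ₀ fun f hf => by
      refine ge_of_tendsto' (hL f b) fun N => ?_
      have : ∀ y, 0 ≤ f y := fun y => hf y
      exact mul_nonneg (by positivity) (Finset.sum_nonneg fun m _ => this _)
  have hΛ : ∀ f, Λ f = L f := fun f => rfl
  let μ := RealRMK.rieszMeasure Λ
  have hint : ∀ f : CompactlySupportedContinuousMap (orbitClosure x) ℝ, ∫ y, f y ∂μ = L f :=
    fun f => by rw [RealRMK.integral_rieszMeasure, hΛ]
  have toCc : ∀ f : orbitClosure x → ℝ, Continuous f →
      ∃ g : CompactlySupportedContinuousMap (orbitClosure x) ℝ, ∀ y, g y = f y := fun f hf =>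
    ⟨⟨⟨f, hf⟩, HasCompactSupport.of_compactSpace f⟩, fun y => rfl⟩
  have hprob : IsProbabilityMeasure μ := by
    obtain ⟨g, hg⟩ := toCc (fun _ => 1) continuous_const
    have h1 : L g = 1 := by
      refine tendsto_nhds_unique (hL g b) ((tendsto_congr' ?_).2 tendsto_const_nhds)
      filter_upwards [eventually_ge_atTop 1] with N hN
      have hNc : (N : ℝ) ≠ 0 := by exact_mod_cast (by omega : N ≠ 0)
      simp [A, hg, hNc]
    have h2 := hint g
    simp only [hg, integral_const, smul_eq_mul, mul_one, h1] at h2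
    rw [isProbabilityMeasure_iff_real]
    exact h2
  refine ⟨μ, hprob, (continuous_orbitClosure_sigma 1).measurable, ?_⟩
  have : IsProbabilityMeasure (Measure.map (sigma x 1) μ) :=
    Measure.isProbabilityMeasure_map (continuous_orbitClosure_sigma 1).measurable.aemeasurable
  refine ext_of_forall_integral_eq_of_IsFiniteMeasure fun f => ?_
  rw [integral_map (continuous_orbitClosure_sigma 1).measurable.aemeasurable f.continuous.aestronglyMeasurable]
  obtain ⟨g, hg⟩ := toCc f f.continuous
  obtain ⟨g', hg'⟩ := toCc (fun y => f (sigma x 1 y)) (f.continuous.comp (continuous_orbitClosure_sigma 1))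
  simp_rw [← hg', ← hg, hint]
  -- Averages of `f ∘ σ` at `b` are averages of `f` at `σ b`, and the limit does not depend on the
  -- point.
  refine tendsto_nhds_unique (hL g' b) ((hL g (sigma x 1 b)).congr fun N => ?_)
  simp only [A, hg, hg']
  congr 1
  refine Finset.sum_congr rfl fun m _ => ?_
  rw [← sigma_add, ← sigma_add, add_comm]

end UniqueErgodicity

theorem mainTheorem1 (k l : ℕ) (hk : 1 < k) (hl : 1 < l) (hkl : k ≠ l) :
    ∃ x : Word, IsToeplitz x ∧ IsRegularToeplitz x ∧
      (∀ F : orbitClosure x → ℂ, Continuous F → ∀ y : orbitClosure x,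
        ∃ L : ℂ, Tendsto (powerAverage x l F y) atTop (𝓝 L)) ∧
      (¬ ∃ L : ℂ, Tendsto (powerAverage x k (signZero x) (basePoint x)) atTop (𝓝 L)) ∧
      (Odd l → (∃ q : ℕ, q.Prime ∧ q ∣ k ∧ ¬ q ∣ l) →
        ∃ μ : Measure (orbitClosure x), IsInvariantProbability x μ ∧
          (∀ ν : Measure (orbitClosure x), IsInvariantProbability x ν → ν = μ) ∧
          ∀ F : orbitClosure x → ℂ, Continuous F → ∀ y : orbitClosure x,
            Tendsto (powerAverage x l F y) atTop (𝓝 (∫ z, F z ∂μ))) := by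
  obtain ⟨n, W, S⟩ := exists_isSkeleton hk hl hkl
  have hk0 : 0 < k := by omega
  refine ⟨skeletonWord W, S.isToeplitz hk0, S.isRegularToeplitz hk0,
    fun F hF y => S.exists_tendsto_powerAverage (Or.inr rfl) hF y, S.not_tendsto_powerAverage,
    fun hodd hq => ?_⟩
  have hlim : ∀ F : orbitClosure (skeletonWord W) → ℂ, Continuous F → ∃ L : ℂ, ∀ y,
      Tendsto (powerAverage (skeletonWord W) 1 F y) atTop (𝓝 L) := by
    intro F hF
    obtain ⟨L, hL⟩ := S.exists_common_limit ⟨hodd, hq⟩ hF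
    exact ⟨L, hL 1 (Or.inl rfl)⟩
  obtain ⟨μ, hμ⟩ := exists_isInvariantProbability hlim
  refine ⟨μ, hμ, fun ν hν => ext_of_isInvariantProbability hμ hν hlim, fun F hF y => ?_⟩
  obtain ⟨L, hL⟩ := S.exists_common_limit ⟨hodd, hq⟩ hF
  rw [integral_eq_of_tendsto hμ hF (hL 1 (Or.inl rfl))]
  exact hL l (Or.inr rfl) y
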